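/- Let $n\ge 4$ and let $h_1,\dots,h_n$ be the standard basis of $\mathbb{E}^n$. A family (of $(n-1)$-dimensional spherical simplices) is the set of the $2^n$ simplices into which $n$ hyperplanes through the origin, with linearly independent normal vectors $f_1,\dots,f_n$, decompose the unit sphere $S^{n-1}\subset\mathbb{E}^n$. The family generates $D_n$ if, up to an isometry of $S^{n-1}$, the group generated by the reflections in these $n$ hyperplanes is the reflection group of the root system $\Delta(D_n)=\{\pm h_i\pm h_j : 1\le i<j\le n\}$. Families are considered up to isometries of $S^{n-1}$. Let $M$ be the set of isomorphism classes of finite connected multigraphs with $n$ vertices containing exactly one cycle, where this cycle may consist of two parallel edges but may not be a loop. Consider two pairs of graphs with four vertices: (1) the $4$-cycle, and the double edge with one further edge attached at each of its two ends; (2) the triangle with one further edge attached at one of its vertices, and the double edge with two further edges attached at the same end. Let $\Gamma_1$ be a graph of pair (1) and $\Gamma_2$ a graph of pair (2) (for instance the $4$-cycle and the triangle with one further edge). Then the families generating $D_n$, up to isometry, are in one-to-one correspondence with the graphs in $M\setminus\{\Gamma_1,\Gamma_2\}$. Moreover, the following correspondence is such a bijection: a graph $\Sigma\in M\setminus\{\Gamma_1,\Gamma_2\}$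 corresponds to a family $\Phi$ generating $D_n$ if and only if, up to an isometry, $\Phi$ has normal vectors $f_1,\dots,f_n\in\Delta(D_n)$ such that $\Sigma$ is isomorphic to the multigraph with vertices $h_1,\dots,h_n$ and one edge $f_k$ for each $k$, joining $h_i$ and $h_j$ if $f_k=\pm h_i\pm h_j$. -/

import Mathlib

open scoped Graph

namespace DnFamilies

/-! ### Multigraphs -/

section Multigraphs

variable {α β γ δ : Type*}

/-- The multigraph on the whole vertex type `α` whose edge `e` has the two ends `ends e`. -/
def ofEnds (ends : β → Sym2 α) : Graph α β where
  vertexSet := Set.univ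
  IsLink e x y := ends e = s(x, y)
  isLink_symm _ _ := ⟨fun _ _ h => h.trans Sym2.eq_swap⟩
  eq_or_eq_of_isLink_of_isLink e x y v w h₁ h₂ := by
    have h : s(x, y) = s(v, w) := h₁.symm.trans h₂
    rcases Sym2.eq_iff.mp h with h | h
    · exact Or.inl h.1
    · exact Or.inr h.1
  left_mem_of_isLink _ _ _ _ := Set.mem_univ _

/-- Isomorphism of multigraphs: a bijection of vertices and a bijection of edges that
respect the ends of the edges. -/
def GraphIso (G : Graph α β) (H : Graph γ δ) : Prop :=
  ∃ (φ : V(G) ≃ V(H)) (ψ : E(G) ≃ E(H)), ∀ (e : E(G)) (x y : V(G)),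
    G.IsLink e x y ↔ H.IsLink (ψ e) (φ x) (φ y)

theorem GraphIso.refl (G : Graph α β) : GraphIso G G :=
  ⟨Equiv.refl _, Equiv.refl _, fun _ _ _ => Iff.rfl⟩

theorem GraphIso.symm {G : Graph α β} {H : Graph γ δ} (h : GraphIso G H) : GraphIso H G := by
  obtain ⟨φ, ψ, h⟩ := h
  refine ⟨φ.symm, ψ.symm, fun e x y => ?_⟩
  simpa using (h (ψ.symm e) (φ.symm x) (φ.symm y)).symm

theorem GraphIso.trans {ε ζ : Type*} {G : Graph α β} {H : Graph γ δ} {K : Graph ε ζ}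
    (h₁ : GraphIso G H) (h₂ : GraphIso H K) : GraphIso G K := by
  obtain ⟨φ₁, ψ₁, h₁⟩ := h₁
  obtain ⟨φ₂, ψ₂, h₂⟩ := h₂
  exact ⟨φ₁.trans φ₂, ψ₁.trans ψ₂, fun e x y =>
    (h₁ e x y).trans (h₂ (ψ₁ e) (φ₁ x) (φ₁ y))⟩

/-- A multigraph is connected if it has a vertex and any two of its vertices are joined by a
path. -/
def IsConnected (G : Graph α β) : Prop :=
  V(G).Nonempty ∧ ∀ x ∈ V(G), ∀ y ∈ V(G), Relation.ReflTransGen G.Adj x y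

/-- `C` is the edge set of a cycle of `G`: the cycle has `k + 1` distinct vertices `v i` and
`k + 1` distinct edges `e i`, and `e i` joins `v i` to the cyclically next vertex. So a loop is
a cycle with one vertex, and two parallel edges form a cycle with two vertices. -/
def IsCycle (G : Graph α β) (C : Set β) : Prop :=
  ∃ (k : ℕ) (v : Fin (k + 1) → α) (e : Fin (k + 1) → β),
    Function.Injective v ∧ Function.Injective e ∧
    (∀ i, G.IsLink (e i) (v i) (v (i + 1))) ∧ C = Set.range e

/-- Finite connected multigraphs with exactly one cycle, this cycle not being a loop
(it may consist of two parallel edges). -/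
def IsUnicyclic (G : Graph α β) : Prop :=
  E(G).Finite ∧ IsConnected G ∧ G.Loopless ∧ ∃! C : Set β, IsCycle G C

end Multigraphs

/-- The cycle with four vertices. -/
def fourCycle : Graph (Fin 4) (Fin 4) :=
  ofEnds ![s(0, 1), s(1, 2), s(2, 3), s(3, 0)]

/-- A double edge with one further edge attached at each of its two ends. -/
def doubleEdgeTwoSided : Graph (Fin 4) (Fin 4) :=
  ofEnds ![s(0, 1), s(0, 1), s(0, 2), s(1, 3)]

/-- The triangle with one further edge attached at one of its vertices. -/
def triangleWithPendantEdge : Graph (Fin 4) (Fin 4) :=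
  ofEnds ![s(0, 1), s(1, 2), s(2, 0), s(0, 3)]

/-- A double edge with two further edges attached at the same end. -/
def doubleEdgeOneSided : Graph (Fin 4) (Fin 4) :=
  ofEnds ![s(0, 1), s(0, 1), s(0, 2), s(0, 3)]

/-- The connected multigraphs with `n` vertices and exactly one cycle, except those isomorphic
to `Γ₁` or `Γ₂` (edges carry names in `ℕ`). -/
def AdmissibleGraph (n : ℕ) (Γ₁ Γ₂ : Graph (Fin 4) (Fin 4)) : Type :=
  {G : Graph (Fin n) ℕ // V(G) = Set.univ ∧ IsUnicyclic G ∧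
    ¬ GraphIso G Γ₁ ∧ ¬ GraphIso G Γ₂}

instance admissibleGraphSetoid (n : ℕ) (Γ₁ Γ₂ : Graph (Fin 4) (Fin 4)) :
    Setoid (AdmissibleGraph n Γ₁ Γ₂) where
  r G H := GraphIso G.1 H.1
  iseqv := ⟨fun G => GraphIso.refl G.1, fun h => h.symm, fun h₁ h₂ => h₁.trans h₂⟩

/-- Admissible graphs up to isomorphism. -/
abbrev GraphClass (n : ℕ) (Γ₁ Γ₂ : Graph (Fin 4) (Fin 4)) : Type :=
  Quotient (admissibleGraphSetoid n Γ₁ Γ₂)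

/-! ### Spherical simplices, families, and the groups they generate -/

/-- Euclidean `n`-space; the simplices live on its unit sphere, which has dimension `n - 1`. -/
abbrev Space (n : ℕ) : Type := EuclideanSpace ℝ (Fin n)

/-- The set of points of the unit sphere at which all the outward normals `f i` are nonpositive:
for linearly independent `f`, the spherical simplex with outward normals `f i`
(the lengths of the normals do not matter). -/
def simplex {n : ℕ} (f : Fin n → Space n) : Set (Space n) :=
  {x | ‖x‖ = 1 ∧ ∀ i, inner ℝ (f i) x ≤ 0}

/-- The `2 ^ n` simplices `{± f 1, …, ± f n}` into which the hyperplanes orthogonal to the `f i`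
decompose the unit sphere. -/
def simplicesOf {n : ℕ} (f : Fin n → Space n) : Set (Set (Space n)) :=
  {P | ∃ ε : Fin n → ℤˣ, P = simplex (fun i => ((ε i : ℤ) : ℝ) • f i)}

/-- The simplices of `S` are the simplices `{± f 1, …, ± f n}`, for linearly independent `f`. -/
def Represents {n : ℕ} (f : Fin n → Space n) (S : Set (Set (Space n))) : Prop :=
  LinearIndependent ℝ f ∧ S = simplicesOf f

/-- A family of `(n - 1)`-dimensional spherical simplices: the set of all simplices cut out of
the unit sphere of `n`-space by `n` hyperplanes with linearly independent normals. -/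
def IsFamily {n : ℕ} (S : Set (Set (Space n))) : Prop :=
  ∃ f : Fin n → Space n, Represents f S

/-- Two sets of subsets of the sphere are isometric if an isometry of the sphere takes the
members of the first to the members of the second. -/
def FamilyIsometric {n : ℕ} (S S' : Set (Set (Space n))) : Prop :=
  ∃ T : Space n ≃ₗᵢ[ℝ] Space n, (fun P : Set (Space n) => T '' P) '' S = S'

theorem FamilyIsometric.refl {n : ℕ} (S : Set (Set (Space n))) : FamilyIsometric S S :=
  ⟨LinearIsometryEquiv.refl ℝ _, by simp⟩

theorem FamilyIsometric.symm {n : ℕ} {S S' : Set (Set (Space n))} (h : FamilyIsometric S S') :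
    FamilyIsometric S' S := by
  obtain ⟨T, rfl⟩ := h
  exact ⟨T.symm, by simp [Set.image_image]⟩

theorem FamilyIsometric.trans {n : ℕ} {S S' S'' : Set (Set (Space n))}
    (h₁ : FamilyIsometric S S') (h₂ : FamilyIsometric S' S'') : FamilyIsometric S S'' := by
  obtain ⟨T, rfl⟩ := h₁
  obtain ⟨T', rfl⟩ := h₂
  exact ⟨T.trans T', by simp [Set.image_image]⟩

/-- The group of isometries generated by the reflections in the hyperplanes orthogonal to the
vectors of a set `A`. -/
noncomputable def reflectionGroup {n : ℕ} (A : Set (Space n)) :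
    Subgroup (Space n ≃ₗᵢ[ℝ] Space n) :=
  Subgroup.closure ((fun v => (ℝ ∙ v)ᗮ.reflection) '' A)

/-- `v` is one of `h x + h y`, `h x - h y`, `- h x + h y`, `- h x - h y`, where `h` is the standard
basis. -/
def IsRootOn {n : ℕ} (v : Space n) (x y : Fin n) : Prop :=
  ∃ s t : ℤˣ, v = ((s : ℤ) : ℝ) • EuclideanSpace.single x (1 : ℝ) +
    ((t : ℤ) : ℝ) • EuclideanSpace.single y (1 : ℝ)

/-- The root system `D n`, consisting of the vectors `± h x ± h y` with `x ≠ y`. -/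
def rootsD (n : ℕ) : Set (Space n) :=
  {v | ∃ x y : Fin n, x ≠ y ∧ IsRootOn v x y}

/-- A family, with face normals `± f i`, generates `D n`: up to an isometry, the reflections in
the hyperplanes of its faces generate the reflection group of the root system `D n`. -/
def GeneratesD {n : ℕ} (S : Set (Set (Space n))) : Prop :=
  ∃ f : Fin n → Space n, Represents f S ∧ ∃ T : Space n ≃ₗᵢ[ℝ] Space n,
    (reflectionGroup (Set.range f)).map (MulAut.conj T).toMonoidHom = reflectionGroup (rootsD n)

/-- The families generating `D n`. -/
def FamilyD (n : ℕ) : Type :=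
  {S : Set (Set (Space n)) // IsFamily S ∧ GeneratesD S}

instance familySetoid (n : ℕ) : Setoid (FamilyD n) where
  r S S' := FamilyIsometric S.1 S'.1
  iseqv := ⟨fun S => FamilyIsometric.refl S.1, fun h => h.symm, fun h₁ h₂ => h₁.trans h₂⟩

/-- The families generating `D n`, up to isometry. -/
abbrev FamilyClass (n : ℕ) : Type := Quotient (familySetoid n)

/-! ### The graph of a system of roots -/

theorem isRootOn_apply_ne_zero {n : ℕ} {v : Space n} {x y : Fin n} (hxy : x ≠ y)
    (h : IsRootOn v x y) (z : Fin n) : v z ≠ 0 ↔ z = x ∨ z = y := by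
  obtain ⟨s, t, rfl⟩ := h
  rcases Int.units_eq_one_or s with rfl | rfl <;> rcases Int.units_eq_one_or t with rfl | rfl <;>
    by_cases hx : z = x <;> by_cases hy : z = y <;> simp_all

/-- The graph of a system `f` of roots: its vertices stand for the standard basis vectors, and
each `f k` of the form `± h x ± h y` gives an edge `k` joining `x` and `y`. -/
def graphOf {n : ℕ} (f : Fin n → Space n) : Graph (Fin n) (Fin n) where
  vertexSet := Set.univ
  IsLink k x y := x ≠ y ∧ IsRootOn (f k) x y
  isLink_symm _ _ := ⟨fun _ _ ⟨hxy, s, t, h⟩ => ⟨hxy.symm, t, s, h.trans (add_comm _ _)⟩⟩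
  eq_or_eq_of_isLink_of_isLink k x y v w h₁ h₂ :=
    (isRootOn_apply_ne_zero h₂.1 h₂.2 x).mp
      ((isRootOn_apply_ne_zero h₁.1 h₁.2 x).mpr (Or.inl rfl))
  left_mem_of_isLink _ _ _ _ := Set.mem_univ _

/-- The family `S` has, up to isometry, an embedding into the root system `D n` whose graph
is `G`. -/
def HasGraph {n : ℕ} {β : Type*} (S : Set (Set (Space n))) (G : Graph (Fin n) β) : Prop :=
  ∃ f : Fin n → Space n, LinearIndependent ℝ f ∧ (∀ k, f k ∈ rootsD n) ∧
    FamilyIsometric (simplicesOf f) S ∧ GraphIso (graphOf f) G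

end DnFamilies

/-! A system of `n` roots of `D n` is a signed multigraph: each root gives an edge between two basis
vectors, and its two coefficients determine a sign. The theorem rests on three facts.

Families and graphs. The only reflections in the group of `D n` are those in its roots
(`exists_smul_root_of_reflection_mem`), so the normals of a generating family may be taken to be
roots. Independent roots generate the group exactly when their graph is connected
(`reflectionGroup_eq_of_isConnected`, `isConnected_of_reflectionGroup_eq`). A connected loopless
graph has as many edges as vertices exactly when it has one cycle (`existsUnique_isCycle_iff_card`,
a dimension count for the boundary map modulo 2).

The graph determines the family. Negating a basis vector is an isometry, and negating a root does
not change its hyperplane. Independence forces the cycle to be unbalanced, and up to these changes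
there is only one such choice of signs (`familyIsometric_almostBalancedRoots`).

The family determines the graph. The simplices determine the normals up to order and scaling
(`exists_smul_of_simplicesOf_eq`), so an isometry of families carries roots to roots up to sign. For
`n ≥ 5` the vectors `± h x` are the only unit vectors with integral inner products with all roots;
the isometry is then a signed permutation of the basis and induces a graph isomorphism
(`graphIso_of_familyIsometric`). In dimension four there are further such unit vectors and further
isometries: the reflection in the hyperplane orthogonal to `(1, 1, 1, 1)` identifies the two graphs
of each exceptional pair (`shareFamily_fourCycle`, `shareFamily_triangle`). Nothing else is
identified, because the number of pairs of normals with inner product `± 1` separates the remaining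
classes (`exists_model_of_not_graphIso`). -/

namespace DnFamilies

/-! ### Cycle space modulo 2 and unicyclic graphs -/

section Cycles

variable {V β : Type*}

@[simp] theorem ofEnds_isLink {a : β → Sym2 V} {k : β} {x y : V} :
    (ofEnds a).IsLink k x y ↔ a k = s(x, y) := Iff.rfl

@[simp] theorem ofEnds_vertexSet (a : β → Sym2 V) : V(ofEnds a) = Set.univ := rfl

@[simp] theorem ofEnds_edgeSet (a : β → Sym2 V) : E(ofEnds a) = Set.univ := by
  refine Set.eq_univ_of_forall fun k => ?_
  induction hk : a k using Sym2.ind with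
  | h x y => exact ⟨x, y, hk⟩

theorem ofEnds_loopless {a : β → Sym2 V} : (ofEnds a).Loopless ↔ ∀ k, ¬ (a k).IsDiag := by
  constructor
  · intro h k hk
    induction hak : a k using Sym2.ind with
    | h x y =>
      rw [hak, Sym2.mk_isDiag_iff] at hk
      subst hk
      exact h.not_isLoopAt k x hak
  · intro h
    refine ⟨fun k x hx => h k ?_⟩
    rw [show a k = s(x, x) from hx]
    exact rfl

theorem isConnected_ofEnds {a : β → Sym2 V} :
    IsConnected (ofEnds a) ↔
      Nonempty V ∧ ∀ x y, Relation.ReflTransGen (fun x y => ∃ k, a k = s(x, y)) x y := by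
  simp only [IsConnected, ofEnds_vertexSet, Set.mem_univ, forall_const, ← Set.nonempty_iff_univ_nonempty]
  rfl

/-- A property of vertices that is constant along edges is constant on a connected graph. -/
theorem IsConnected.eq_of_forall_link {a : β → Sym2 V} (h : IsConnected (ofEnds a))
    {γ : Type*} (φ : V → γ) (hφ : ∀ k x y, a k = s(x, y) → φ x = φ y) (x y : V) : φ x = φ y := by
  have := (isConnected_ofEnds.mp h).2 x y
  induction this with
  | refl => rfl
  | tail _ hbc ih =>
    obtain ⟨k, hk⟩ := hbc
    exact ih.trans (hφ k _ _ hk)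

variable [DecidableEq V]

/-- The sum of the two ends of an edge, modulo 2. -/
def incidence : Sym2 V → V → ZMod 2 :=
  Sym2.lift ⟨fun x y => Pi.single x 1 + Pi.single y 1, fun _ _ => add_comm _ _⟩

@[simp] theorem incidence_mk (x y : V) :
    incidence s(x, y) = Pi.single x 1 + Pi.single y 1 := rfl

theorem pi_zmod_two_add_self {ι : Type*} (w : ι → ZMod 2) : w + w = 0 :=
  funext fun _ => CharTwo.add_self_eq_zero _

theorem IsCycle.nonempty {α : Type*} {G : Graph α β} {C : Set β} (hC : IsCycle G C) :
    C.Nonempty := by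
  obtain ⟨k, v, e, -, -, -, rfl⟩ := hC
  exact ⟨e 0, 0, rfl⟩

variable [Fintype β]

/-- The boundary map modulo 2. -/
def boundary (a : β → Sym2 V) : (β → ZMod 2) →ₗ[ZMod 2] (V → ZMod 2) :=
  Fintype.linearCombination (ZMod 2) (fun k => incidence (a k))

theorem boundary_apply (a : β → Sym2 V) (c : β → ZMod 2) :
    boundary a c = ∑ k, c k • incidence (a k) := rfl

theorem boundary_single [DecidableEq β] (a : β → Sym2 V) (k : β) :
    boundary a (Pi.single k 1) = incidence (a k) := by
  simp [boundary, Fintype.linearCombination_apply_single]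

theorem sum_mul_incidence [Fintype V] (u : V → ZMod 2) (x y : V) :
    ∑ v, u v * incidence s(x, y) v = u x + u y := by
  simp [mul_add, Finset.sum_add_distrib, Pi.single_apply]

/-- The coboundary is adjoint to the boundary. When `u` is the indicator of a vertex set, the right
side sums `c` over the edges leaving that set; the cut arguments below use this form. -/
theorem sum_mul_boundary [Fintype V] (a : β → Sym2 V) (u : V → ZMod 2) (c : β → ZMod 2) :
    ∑ v, u v * boundary a c v = ∑ k, c k * ∑ v, u v * incidence (a k) v := by
  simp only [boundary_apply, Finset.sum_apply, Pi.smul_apply, smul_eq_mul, Finset.mul_sum]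
  rw [Finset.sum_comm]
  exact Finset.sum_congr rfl fun k _ => Finset.sum_congr rfl fun v _ => by ring

/-- The edges of a cycle have boundary zero. -/
theorem IsCycle.boundary_indicator {a : β → Sym2 V} {C : Set β} (hC : IsCycle (ofEnds a) C) :
    boundary a (C.indicator 1) = 0 := by
  classical
  obtain ⟨k, v, e, -, he, hl, rfl⟩ := hC
  have h1 : ((Set.range e).indicator 1 : β → ZMod 2) = ∑ i, Pi.single (e i) 1 := by
    ext b
    rw [Finset.sum_apply]
    by_cases hb : b ∈ Set.range e
    · obtain ⟨i, rfl⟩ := hb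
      rw [Set.indicator_of_mem (Set.mem_range_self i)]
      rw [Finset.sum_eq_single i]
      · simp
      · intro j _ hj
        rw [Pi.single_eq_of_ne]
        exact fun h => hj (he h).symm
      · simp
    · rw [Set.indicator_of_notMem hb, Finset.sum_eq_zero]
      intro i _
      rw [Pi.single_eq_of_ne]
      rintro rfl
      exact hb ⟨i, rfl⟩
  rw [h1, map_sum]
  have h2 : ∀ i, boundary a (Pi.single (e i) 1) = Pi.single (v i) 1 + Pi.single (v (i + 1)) 1 := by
    intro i
    rw [boundary_single, ofEnds_isLink.mp (hl i), incidence_mk]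
  simp only [h2, Finset.sum_add_distrib]
  -- Shifting the cyclic index identifies the two vertex sums, which therefore cancel modulo 2.
  have h3 := Equiv.sum_comp (Equiv.addRight (1 : Fin (k + 1)))
    (fun i => (Pi.single (v i) 1 : V → ZMod 2))
  simp only [Equiv.coe_addRight] at h3
  rw [h3]
  exact pi_zmod_two_add_self _

/-- An edge of a mod 2 cycle lies on a cycle within its support. -/
theorem exists_isCycle_of_boundary_eq_zero [Fintype V] {a : β → Sym2 V}
    (hl : (ofEnds a).Loopless) {c : β → ZMod 2} (hc : boundary a c = 0) {k₀ : β}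
    (hk₀ : c k₀ ≠ 0) :
    ∃ C, IsCycle (ofEnds a) C ∧ k₀ ∈ C ∧ ∀ k ∈ C, c k ≠ 0 := by
  classical
  obtain ⟨x, y, hxy⟩ : ∃ x y, a k₀ = s(x, y) := by
    induction hk : a k₀ using Sym2.ind with
    | h x y => exact ⟨x, y, rfl⟩
  have hne : x ≠ y := by
    rintro rfl
    exact hl.not_isLoopAt k₀ x hxy
  let H : SimpleGraph V :=
    { Adj := fun p q => p ≠ q ∧ ∃ k, k ≠ k₀ ∧ c k ≠ 0 ∧ a k = s(p, q)
      symm := ⟨fun p q ⟨h, k, h1, h2, h3⟩ => ⟨h.symm, k, h1, h2, h3.trans Sym2.eq_swap⟩⟩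
      loopless := ⟨fun p h => h.1 rfl⟩ }
  -- Otherwise pair the boundary of `c` with the indicator of the component of `x` in the support
  -- without `k₀`. Only `k₀` crosses this cut, so the pairing equals `c k₀`, which is nonzero.
  have hreach : H.Reachable x y := by
    by_contra hnot
    let u : V → ZMod 2 := fun v => if H.Reachable x v then 1 else 0
    have h0 := sum_mul_boundary a u c
    rw [hc] at h0
    simp only [Pi.zero_apply, mul_zero, Finset.sum_const_zero] at h0
    rw [Finset.sum_eq_single k₀] at h0
    · rw [hxy, sum_mul_incidence] at h0
      simp only [u, hnot, if_false, SimpleGraph.Reachable.refl, if_true, add_zero, mul_one] at h0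
      exact hk₀ h0.symm
    · intro k _ hk
      by_cases hck : c k = 0
      · simp [hck]
      induction hak : a k using Sym2.ind with
      | h p q =>
        have hpq : p ≠ q := by
          rintro rfl
          exact hl.not_isLoopAt k p hak
        have hadj : H.Adj p q := ⟨hpq, k, hk, hck, hak⟩
        have : H.Reachable x p ↔ H.Reachable x q :=
          ⟨fun h => h.trans hadj.reachable, fun h => h.trans hadj.symm.reachable⟩
        rw [sum_mul_incidence]
        have : u p = u q := by simp [u, this]
        rw [this, CharTwo.add_self_eq_zero, mul_zero]
    · simp
  obtain ⟨p, hp⟩ := hreach.exists_isPath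
  have hadj : ∀ i : ℕ, ∃ k, i < p.length →
      k ≠ k₀ ∧ c k ≠ 0 ∧ a k = s(p.getVert i, p.getVert (i + 1)) := by
    intro i
    by_cases hi : i < p.length
    · obtain ⟨-, k, hk⟩ := p.adj_getVert_succ hi
      exact ⟨k, fun _ => hk⟩
    · exact ⟨k₀, fun h => absurd h hi⟩
  choose E hE using hadj
  have hinj : ∀ i j, i ≤ p.length → j ≤ p.length → p.getVert i = p.getVert j → i = j :=
    fun i j hi hj h => hp.getVert_injOn hi hj h
  -- The last index receives `k₀`, which closes the path from `y` back to `x`, the vertex of index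
  -- 0.
  let e : Fin (p.length + 1) → β := fun i => if (i : ℕ) < p.length then E i else k₀
  have he : Function.Injective e := by
    intro i j hij
    have hi := i.2
    have hj := j.2
    ext
    by_cases h1 : (i : ℕ) < p.length <;> by_cases h2 : (j : ℕ) < p.length
    · simp only [e, h1, h2, if_true] at hij
      have h3 := (hE i h1).2.2
      rw [hij, (hE j h2).2.2, Sym2.eq_iff] at h3
      rcases h3 with h3 | h3
      · exact (hinj _ _ (by omega) (by omega) h3.1).symm
      -- Ends matched in reverse order would give `j = i + 1` and `j + 1 = i`.
      · have := hinj _ _ (by omega) (by omega) h3.1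
        have := hinj _ _ (by omega) (by omega) h3.2
        omega
    · simp only [e, h1, h2, if_true, if_false] at hij
      exact absurd hij (hE i h1).1
    · simp only [e, h1, h2, if_true, if_false] at hij
      exact absurd hij.symm (hE j h2).1
    · omega
  refine ⟨Set.range e, ⟨p.length, fun i => p.getVert i, e, ?_, he, ?_, rfl⟩, ?_, ?_⟩
  · intro i j hij
    ext
    exact hinj _ _ (by omega) (by omega) hij
  · intro i
    rw [ofEnds_isLink]
    by_cases h1 : (i : ℕ) < p.length
    · have : ((i + 1 : Fin (p.length + 1)) : ℕ) = i + 1 := by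
        rw [Fin.val_add_one_of_lt]
        simpa [Fin.lt_def] using h1
      simp only [e, h1, if_true, this]
      exact (hE i h1).2.2
    · have hi : i = Fin.last p.length := by
        ext
        simp only [Fin.val_last]
        omega
      subst hi
      simp [e, hxy]
  · exact ⟨Fin.last _, by simp [e]⟩
  · rintro _ ⟨i, rfl⟩
    by_cases h1 : (i : ℕ) < p.length
    · simp only [e, h1, if_true]
      exact (hE i h1).2.1
    · simp only [e, h1, if_false]
      exact hk₀

/-- A loopless graph has exactly one cycle if and only if its cycle space mod 2 has dimension
one. -/
theorem existsUnique_isCycle_iff [Fintype V] {a : β → Sym2 V} (hl : (ofEnds a).Loopless) :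
    (∃! C, IsCycle (ofEnds a) C) ↔ Module.finrank (ZMod 2) (LinearMap.ker (boundary a)) = 1 := by
  classical
  have h2 : ∀ z : ZMod 2, z ≠ 0 → z = 1 := by decide
  have hind : ∀ C, IsCycle (ofEnds a) C → (C.indicator 1 : β → ZMod 2) ≠ 0 := by
    intro C hC h
    obtain ⟨k, hk⟩ := hC.nonempty
    have := congrFun h k
    simp [hk] at this
  rw [finrank_eq_one_iff']
  constructor
  -- Each edge in the support of a kernel vector lies on a cycle inside that support. The only cycle
  -- being `C`, the support of a nonzero kernel vector is `C`.
  · rintro ⟨C, hC, huniq⟩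
    refine ⟨⟨C.indicator 1, hC.boundary_indicator⟩,
      fun h => hind C hC (congrArg Subtype.val h), ?_⟩
    rintro ⟨c, hc⟩
    rw [LinearMap.mem_ker] at hc
    by_cases hc0 : c = 0
    · exact ⟨0, Subtype.ext (by simp [hc0])⟩
    refine ⟨1, ?_⟩
    rw [one_smul]
    ext k
    simp only
    by_cases hk : k ∈ C
    · rw [Set.indicator_of_mem hk]
      obtain ⟨k₀, hk₀⟩ := Function.ne_iff.mp hc0
      obtain ⟨C', hC', -, hs⟩ := exists_isCycle_of_boundary_eq_zero hl hc hk₀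
      rw [← huniq C' hC'] at hk
      exact (h2 _ (hs k hk)).symm
    · rw [Set.indicator_of_notMem hk]
      by_contra hck
      obtain ⟨C', hC', hk', -⟩ := exists_isCycle_of_boundary_eq_zero hl hc (Ne.symm hck)
      rw [huniq C' hC'] at hk'
      exact hk hk'
  · rintro ⟨⟨c, hc⟩, hc0, huniq⟩
    have hc0' : c ≠ 0 := fun h => hc0 (Subtype.ext h)
    obtain ⟨k₀, hk₀⟩ := Function.ne_iff.mp hc0'
    obtain ⟨C, hC, -, -⟩ := exists_isCycle_of_boundary_eq_zero hl (LinearMap.mem_ker.mp hc) hk₀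
    have key : ∀ D, IsCycle (ofEnds a) D → (D.indicator 1 : β → ZMod 2) = c := by
      intro D hD
      obtain ⟨z, hz⟩ := huniq ⟨D.indicator 1, hD.boundary_indicator⟩
      have hz' := congrArg Subtype.val hz
      simp only [SetLike.mk_smul_mk] at hz'
      have : z ≠ 0 := by
        rintro rfl
        exact hind D hD (by rw [← hz', zero_smul])
      rw [h2 z this, one_smul] at hz'
      exact hz'.symm
    refine ⟨C, hC, fun D hD => ?_⟩
    exact Set.indicator_one_inj (M₀ := ZMod 2) ((key D hD).trans (key C hC).symm)

/-- The image of the boundary map of a connected graph has codimension one. -/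
theorem finrank_range_boundary [Fintype V] {a : β → Sym2 V} (h : IsConnected (ofEnds a)) :
    Module.finrank (ZMod 2) (LinearMap.range (boundary a)) + 1 = Fintype.card V := by
  classical
  let σ : (V → ZMod 2) →ₗ[ZMod 2] ZMod 2 := ∑ v, LinearMap.proj v
  have hσ : ∀ w, σ w = ∑ v, w v := fun w => by simp [σ]
  obtain ⟨x₀⟩ := (isConnected_ofEnds.mp h).1
  have hmem : ∀ x, (Pi.single x 1 + Pi.single x₀ 1 : V → ZMod 2) ∈ LinearMap.range (boundary a) := by
    intro x
    induction (isConnected_ofEnds.mp h).2 x₀ x with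
    | refl =>
      rw [pi_zmod_two_add_self]
      exact zero_mem _
    | @tail y z _ hyz ih =>
      obtain ⟨k, hk⟩ := hyz
      have h1 : (Pi.single y 1 + Pi.single z 1 : V → ZMod 2) ∈ LinearMap.range (boundary a) :=
        ⟨Pi.single k 1, by rw [boundary_single, hk, incidence_mk]⟩
      have := add_mem h1 ih
      convert this using 1
      have h0 := pi_zmod_two_add_self (Pi.single y 1 : V → ZMod 2)
      linear_combination -h0
  -- A vector with coordinate sum zero is a combination of the vectors at `v` and `x₀` treated in
  -- `hmem`, which are boundaries of walks; conversely every edge has two ends.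
  have hrange : LinearMap.range (boundary a) = LinearMap.ker σ := by
    apply le_antisymm
    · rintro _ ⟨c, rfl⟩
      rw [LinearMap.mem_ker, hσ]
      have := sum_mul_boundary a 1 c
      simp only [Pi.one_apply, one_mul] at this
      rw [this]
      refine Finset.sum_eq_zero fun k _ => ?_
      induction a k using Sym2.ind with
      | h p q =>
        have := sum_mul_incidence (1 : V → ZMod 2) p q
        simp only [Pi.one_apply, one_mul] at this
        rw [this, CharTwo.add_self_eq_zero, mul_zero]
    · intro w hw
      rw [LinearMap.mem_ker, hσ] at hw
      have : w = ∑ v, w v • (Pi.single v 1 + Pi.single x₀ 1 : V → ZMod 2) := by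
        simp only [smul_add, Finset.sum_add_distrib, ← Finset.sum_smul, hw, zero_smul, add_zero]
        exact pi_eq_sum_univ' w |>.trans (Finset.sum_congr rfl fun v _ => by congr 1)
      rw [this]
      exact Submodule.sum_mem _ fun v _ => Submodule.smul_mem _ _ (hmem v)
  have hsurj : LinearMap.range σ = ⊤ := by
    rw [LinearMap.range_eq_top]
    intro z
    refine ⟨Pi.single x₀ z, ?_⟩
    simp [hσ]
  have := LinearMap.finrank_range_add_finrank_ker σ
  rw [hsurj, finrank_top, Module.finrank_self, Module.finrank_fintype_fun_eq_card] at this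
  rw [hrange]
  omega

/-- A connected loopless graph has exactly one cycle if and only if it has as many edges as
vertices. -/
theorem existsUnique_isCycle_iff_card [Fintype V] {a : β → Sym2 V} (hl : (ofEnds a).Loopless)
    (h : IsConnected (ofEnds a)) :
    (∃! C, IsCycle (ofEnds a) C) ↔ Fintype.card β = Fintype.card V := by
  rw [existsUnique_isCycle_iff hl]
  have h1 := finrank_range_boundary h
  have h2 := LinearMap.finrank_range_add_finrank_ker (boundary a)
  rw [Module.finrank_fintype_fun_eq_card] at h2
  omega

theorem isUnicyclic_ofEnds_iff [Fintype V] {a : β → Sym2 V} :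
    IsUnicyclic (ofEnds a) ↔
      IsConnected (ofEnds a) ∧ (ofEnds a).Loopless ∧ Fintype.card β = Fintype.card V := by
  constructor
  · rintro ⟨-, h1, h2, h3⟩
    exact ⟨h1, h2, (existsUnique_isCycle_iff_card h2 h1).mp h3⟩
  · rintro ⟨h1, h2, h3⟩
    exact ⟨Set.toFinite _, h1, h2, (existsUnique_isCycle_iff_card h2 h1).mpr h3⟩

/-- A unicyclic graph stays connected when a suitable edge is removed. -/
theorem IsUnicyclic.exists_isConnected_delete [Fintype V] {a : β → Sym2 V}
    (h : IsUnicyclic (ofEnds a)) :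
    ∃ k₀, IsConnected (ofEnds fun k : {k // k ≠ k₀} => a k.1) := by
  classical
  obtain ⟨-, hc, hl, C, hC, -⟩ := h
  obtain ⟨k₀, hk₀⟩ := hC.nonempty
  refine ⟨k₀, ?_⟩
  have hb := hC.boundary_indicator
  set c : β → ZMod 2 := C.indicator 1
  have hck : c k₀ = 1 := by simp [c, hk₀]
  rw [isConnected_ofEnds]
  refine ⟨(isConnected_ofEnds.mp hc).1, fun x y => ?_⟩
  let R := Relation.ReflTransGen (fun x y => ∃ k : {k // k ≠ k₀}, a k.1 = s(x, y))
  have hRs : ∀ p q z, (∃ k : {k // k ≠ k₀}, a k.1 = s(p, q)) → (R z p ↔ R z q) := by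
    rintro p q z ⟨k, hk⟩
    exact ⟨fun h => h.tail ⟨k, hk⟩, fun h => h.tail ⟨k, hk.trans Sym2.eq_swap⟩⟩
  have key : ∀ k p q, a k = s(p, q) → R x p = R x q := by
    intro k p q hk
    by_cases hkk : k = k₀
    swap
    · exact propext (hRs p q x ⟨⟨k, hkk⟩, hk⟩)
    subst hkk
    -- Were the ends of the removed edge separated, it would be the only edge across the cut, and
    -- pairing the boundary of the cycle with `u` would give 1 instead of 0.
    let u : V → ZMod 2 := fun v => if R x v then 1 else 0
    have h0 := sum_mul_boundary a u c
    rw [hb] at h0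
    simp only [Pi.zero_apply, mul_zero, Finset.sum_const_zero] at h0
    rw [Finset.sum_eq_single k] at h0
    · rw [hk, sum_mul_incidence, hck, one_mul] at h0
      by_cases h1 : R x p <;> by_cases h2 : R x q <;> simp [u, h1, h2] at h0 ⊢
    · intro j _ hj
      induction haj : a j using Sym2.ind with
      | h p q =>
        rw [sum_mul_incidence]
        have : u p = u q := by simp [u, hRs p q x ⟨⟨j, hj⟩, haj⟩]
        rw [this, CharTwo.add_self_eq_zero, mul_zero]
    · simp
  have := (hc.eq_of_forall_link (R x) key x y).to_iff
  have h3 : R x x := Relation.ReflTransGen.refl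
  exact this.mp h3

end Cycles

/-! ### Invariance under isomorphism and renaming of edges -/

section Isomorphisms

variable {α β γ δ : Type*}

theorem GraphIso.isConnected {G : Graph α β} {H : Graph γ δ} (h : GraphIso G H)
    (hG : IsConnected G) : IsConnected H := by
  obtain ⟨φ, ψ, h⟩ := h
  obtain ⟨⟨x₀, hx₀⟩, hc⟩ := hG
  refine ⟨⟨φ ⟨x₀, hx₀⟩, Subtype.coe_prop _⟩, ?_⟩
  have key : ∀ x y, Relation.ReflTransGen G.Adj x y → ∀ hx : x ∈ V(G), ∃ hy : y ∈ V(G),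
      Relation.ReflTransGen H.Adj (φ ⟨x, hx⟩ : γ) (φ ⟨y, hy⟩) := by
    intro x y hxy hx
    induction hxy with
    | refl => exact ⟨hx, Relation.ReflTransGen.refl⟩
    | tail _ hbc ih =>
      obtain ⟨hb, ih⟩ := ih
      obtain ⟨e, he⟩ := hbc
      exact ⟨he.right_mem, ih.tail ⟨_, (h ⟨e, he.edge_mem⟩ ⟨_, hb⟩ ⟨_, he.right_mem⟩).mp he⟩⟩
  intro x hx y hy
  obtain ⟨_, hp⟩ := key _ _ (hc (φ.symm ⟨x, hx⟩) (Subtype.coe_prop _) (φ.symm ⟨y, hy⟩)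
    (Subtype.coe_prop _)) (Subtype.coe_prop _)
  simpa using hp

theorem GraphIso.loopless {G : Graph α β} {H : Graph γ δ} (h : GraphIso G H)
    (hG : G.Loopless) : H.Loopless := by
  obtain ⟨φ, ψ, h⟩ := h.symm
  refine ⟨fun e x hx => ?_⟩
  have hx' : H.IsLink e x x := hx
  exact hG.not_isLoopAt _ _ ((h ⟨e, hx'.edge_mem⟩ ⟨x, hx'.left_mem⟩ ⟨x, hx'.left_mem⟩).mp hx')

theorem IsCycle.subset_edgeSet {G : Graph α β} {C : Set β} (hC : IsCycle G C) : C ⊆ E(G) := by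
  obtain ⟨k, v, e, -, -, hl, rfl⟩ := hC
  rintro _ ⟨i, rfl⟩
  exact (hl i).edge_mem

theorem IsCycle.map {G : Graph α β} {H : Graph γ δ} {φ : V(G) ≃ V(H)} {ψ : E(G) ≃ E(H)}
    (h : ∀ (e : E(G)) (x y : V(G)), G.IsLink e x y ↔ H.IsLink (ψ e) (φ x) (φ y)) {C : Set β}
    (hC : IsCycle G C) : IsCycle H (Subtype.val '' (ψ '' (Subtype.val ⁻¹' C))) := by
  obtain ⟨k, v, e, hv, he, hl, rfl⟩ := hC
  refine ⟨k, fun i => φ ⟨v i, (hl i).left_mem⟩, fun i => ψ ⟨e i, (hl i).edge_mem⟩, ?_, ?_, ?_, ?_⟩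
  · intro i j hij
    exact hv (congrArg Subtype.val (φ.injective (Subtype.ext hij)))
  · intro i j hij
    exact he (congrArg Subtype.val (ψ.injective (Subtype.ext hij)))
  · intro i
    exact (h ⟨e i, (hl i).edge_mem⟩ ⟨_, (hl i).left_mem⟩ ⟨_, (hl (i + 1)).left_mem⟩).mp (hl i)
  · ext f
    constructor
    · rintro ⟨_, ⟨⟨_, hb⟩, ⟨i, rfl⟩, rfl⟩, rfl⟩
      exact ⟨i, rfl⟩
    · rintro ⟨i, rfl⟩
      exact ⟨_, ⟨⟨e i, (hl i).edge_mem⟩, ⟨i, rfl⟩, rfl⟩, rfl⟩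

theorem GraphIso.isUnicyclic {G : Graph α β} {H : Graph γ δ} (h : GraphIso G H)
    (hG : IsUnicyclic G) : IsUnicyclic H := by
  obtain ⟨hf, hc, hl, C, hC, huniq⟩ := hG
  have hc' := h.isConnected hc
  have hl' := h.loopless hl
  obtain ⟨φ, ψ, h⟩ := h
  have h' : ∀ (e : E(H)) (x y : V(H)),
      H.IsLink e x y ↔ G.IsLink (ψ.symm e) (φ.symm x) (φ.symm y) := by
    intro e x y
    simpa using (h (ψ.symm e) (φ.symm x) (φ.symm y)).symm
  refine ⟨?_, hc', hl', _, hC.map h, fun D hD => ?_⟩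
  · have : Finite E(G) := hf
    exact Finite.of_equiv _ ψ
  · rw [← huniq _ (hD.map h')]
    ext f
    constructor
    · intro hf
      exact ⟨⟨f, hD.subset_edgeSet hf⟩, ⟨ψ.symm ⟨f, hD.subset_edgeSet hf⟩,
        ⟨_, ⟨⟨f, hD.subset_edgeSet hf⟩, hf, rfl⟩, rfl⟩, by simp⟩, rfl⟩
    · rintro ⟨_, ⟨e, ⟨_, ⟨d, hd, rfl⟩, hde⟩, rfl⟩, rfl⟩
      have : ψ.symm d = e := Subtype.ext hde
      rw [← this]
      simpa using hd

theorem graphIso_ofEnds {a : β → Sym2 α} {b : δ → Sym2 γ} (φ : α ≃ γ) (ψ : β ≃ δ)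
    (h : ∀ k, b (ψ k) = (a k).map φ) : GraphIso (ofEnds a) (ofEnds b) := by
  refine ⟨(Equiv.Set.univ α).trans (φ.trans (Equiv.Set.univ γ).symm),
    (Equiv.setCongr (ofEnds_edgeSet a)).trans ((Equiv.Set.univ β).trans (ψ.trans
      ((Equiv.Set.univ δ).symm.trans (Equiv.setCongr (ofEnds_edgeSet b)).symm))), ?_⟩
  rintro ⟨e, he⟩ ⟨x, hx⟩ ⟨y, hy⟩
  change a e = s(x, y) ↔ b (ψ e) = s(φ x, φ y)
  rw [h, ← Sym2.map_mk, (Sym2.map.injective φ.injective).eq_iff]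

theorem graphIso_ofEnds_iff {a : β → Sym2 α} {b : δ → Sym2 γ} :
    GraphIso (ofEnds a) (ofEnds b) ↔
      ∃ (φ : α ≃ γ) (ψ : β ≃ δ), ∀ k, b (ψ k) = (a k).map φ := by
  refine ⟨?_, fun ⟨φ, ψ, h⟩ => graphIso_ofEnds φ ψ h⟩
  rintro ⟨φ, ψ, h⟩
  refine ⟨(Equiv.Set.univ α).symm.trans (φ.trans (Equiv.Set.univ γ)),
    (Equiv.Set.univ β).symm.trans ((Equiv.setCongr (ofEnds_edgeSet a)).symm.trans (ψ.trans
      ((Equiv.setCongr (ofEnds_edgeSet b)).trans (Equiv.Set.univ δ)))), fun k => ?_⟩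
  induction hk : a k using Sym2.ind with
  | h x y => exact (h ⟨k, by simp⟩ ⟨x, trivial⟩ ⟨y, trivial⟩).mp hk

/-- A graph on a whole type is given by the ends of its edges. -/
theorem exists_graphIso_ofEnds {G : Graph α β} (hV : V(G) = Set.univ) :
    ∃ a : E(G) → Sym2 α, GraphIso G (ofEnds a) := by
  have h : ∀ e : E(G), ∃ z : Sym2 α, ∀ x y, G.IsLink e x y ↔ z = s(x, y) := by
    rintro ⟨e, he⟩
    obtain ⟨x, y, hxy⟩ := G.exists_isLink_of_mem_edgeSet he
    exact ⟨s(x, y), fun x' y' => hxy.isLink_iff_sym2_eq⟩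
  choose a ha using h
  exact ⟨a, Equiv.setCongr hV, (Equiv.Set.univ _).symm.trans
    (Equiv.setCongr (ofEnds_edgeSet a)).symm, fun e x y => ha e x y⟩

/-- The edges of a unicyclic graph with `n` vertices can be numbered by `Fin n`. -/
theorem IsUnicyclic.exists_graphIso_ofEnds {n : ℕ} {G : Graph (Fin n) β} (hV : V(G) = Set.univ)
    (hG : IsUnicyclic G) : ∃ a : Fin n → Sym2 (Fin n), GraphIso G (ofEnds a) := by
  obtain ⟨a, ha⟩ := DnFamilies.exists_graphIso_ofEnds hV
  have : Fintype E(G) := hG.1.fintype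
  have hcard := (isUnicyclic_ofEnds_iff.mp (ha.isUnicyclic hG)).2.2
  let ψ := Fintype.equivOfCardEq hcard
  exact ⟨a ∘ ψ.symm, ha.trans (graphIso_ofEnds (Equiv.refl _) ψ (by simp))⟩

/-- The edges of a graph can be renamed along an injection. -/
theorem exists_graphIso_edge_embedding (a : β → Sym2 α) (f : β ↪ γ) :
    ∃ G : Graph α γ, V(G) = Set.univ ∧ GraphIso G (ofEnds a) := by
  let G : Graph α γ :=
    { vertexSet := Set.univ
      IsLink := fun e x y => ∃ k, f k = e ∧ a k = s(x, y)
      isLink_symm := fun _ _ => ⟨fun _ _ ⟨k, h1, h2⟩ => ⟨k, h1, h2.trans Sym2.eq_swap⟩⟩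
      eq_or_eq_of_isLink_of_isLink := by
        rintro e x y v w ⟨k, hk, h⟩ ⟨k', hk', h'⟩
        obtain rfl := f.injective (hk.trans hk'.symm)
        exact (ofEnds a).eq_or_eq_of_isLink_of_isLink (e := k) h h'
      left_mem_of_isLink := fun _ _ _ _ => trivial }
  have hl : ∀ k x y, G.IsLink (f k) x y ↔ a k = s(x, y) := by
    intro k x y
    refine ⟨?_, fun h => ⟨k, rfl, h⟩⟩
    rintro ⟨k', hk, h⟩
    rwa [f.injective hk] at h
  have hE : E(G) = Set.range f := by
    ext e
    constructor
    · rintro ⟨x, y, k, hk, -⟩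
      exact ⟨k, hk⟩
    · rintro ⟨k, rfl⟩
      induction hk : a k using Sym2.ind with
      | h x y => exact ⟨x, y, (hl k x y).mpr hk⟩
  refine ⟨G, rfl, GraphIso.symm ⟨Equiv.refl _, (Equiv.setCongr (ofEnds_edgeSet a)).trans
    ((Equiv.Set.univ β).trans ((Equiv.ofInjective f f.injective).trans
      (Equiv.setCongr hE).symm)), ?_⟩⟩
  rintro ⟨k, hk⟩ ⟨x, hx⟩ ⟨y, hy⟩
  exact (hl k x y).symm

end Isomorphisms

/-! ### The hyperplanes of a family are determined by its simplices -/

section Families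

variable {n : ℕ}

theorem inner_left_injective {f : Fin n → Space n} (hf : LinearIndependent ℝ f) {x : Space n}
    (h : ∀ i, inner ℝ (f i) x = 0) : x = 0 := by
  have hspan : Submodule.span ℝ (Set.range f) = ⊤ :=
    hf.span_eq_top_of_card_eq_finrank' (by simp)
  have : x ∈ (Submodule.span ℝ (Set.range f))ᗮ := by
    rw [Submodule.mem_orthogonal]
    intro u hu
    induction hu using Submodule.span_induction with
    | mem u hu =>
      obtain ⟨i, rfl⟩ := hu
      exact h i
    | zero => simp
    | add u v _ _ hu hv => rw [inner_add_left, hu, hv, add_zero]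
    | smul c u _ hu => rw [inner_smul_left, hu, mul_zero]
  rwa [hspan, Submodule.top_orthogonal_eq_bot, Submodule.mem_bot] at this

theorem linearIndependent_of_inner_left_injective {f : Fin n → Space n}
    (h : ∀ x, (∀ i, inner ℝ (f i) x = 0) → x = 0) : LinearIndependent ℝ f := by
  refine linearIndependent_of_top_le_span_of_card_eq_finrank ?_ (by simp)
  rw [top_le_iff, ← Submodule.orthogonal_eq_bot_iff, Submodule.eq_bot_iff]
  intro x hx
  exact h x fun i => (Submodule.mem_orthogonal _ _).mp hx _ (Submodule.subset_span ⟨i, rfl⟩)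

theorem exists_inner_eq {f : Fin n → Space n} (hf : LinearIndependent ℝ f) (c : Fin n → ℝ) :
    ∃ x, ∀ i, inner ℝ (f i) x = c i := by
  let L : Space n →ₗ[ℝ] (Fin n → ℝ) := LinearMap.pi fun i => (innerSL ℝ (f i)).toLinearMap
  have hL : Function.Injective L := by
    rw [← LinearMap.ker_eq_bot, LinearMap.ker_eq_bot']
    exact fun x hx => inner_left_injective hf fun i => congrFun hx i
  obtain ⟨x, hx⟩ := (LinearMap.injective_iff_surjective_of_finrank_eq_finrank (by simp)).mp hL c
  exact ⟨x, fun i => congrFun hx i⟩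

theorem mem_simplex_units_smul {f : Fin n → Space n} {ε : Fin n → ℤˣ} {x : Space n} :
    x ∈ simplex (fun i => ((ε i : ℤ) : ℝ) • f i) ↔
      ‖x‖ = 1 ∧ ∀ i, ((ε i : ℤ) : ℝ) * inner ℝ (f i) x ≤ 0 := by
  simp [simplex, inner_smul_left]

theorem exists_units_mul_nonpos (r : ℝ) : ∃ ε : ℤˣ, ((ε : ℤ) : ℝ) * r ≤ 0 := by
  rcases le_total r 0 with h | h
  · exact ⟨1, by simpa⟩
  · exact ⟨-1, by simpa⟩

theorem simplicesOf_subset_of_smul {f g : Fin n → Space n} (σ : Equiv.Perm (Fin n))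
    (c : Fin n → ℝ) (hc : ∀ i, c i ≠ 0) (h : ∀ i, g i = c i • f (σ i)) :
    simplicesOf g ⊆ simplicesOf f := by
  -- Only the sign of `c i` matters for a half-space, and it is absorbed into the choice of signs
  -- `ε`.
  have hs : ∀ i, ∃ s : ℤˣ, 0 < ((s : ℤ) : ℝ) * c i := by
    intro i
    rcases (hc i).lt_or_gt with h | h
    · exact ⟨-1, by simpa⟩
    · exact ⟨1, by simpa⟩
  choose s hs using hs
  rintro _ ⟨ε, rfl⟩
  refine ⟨fun j => ε (σ.symm j) * s (σ.symm j), ?_⟩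
  ext x
  rw [mem_simplex_units_smul, mem_simplex_units_smul]
  refine and_congr_right fun _ => ?_
  rw [← σ.forall_congr_right (q := fun j =>
    (((ε (σ.symm j) * s (σ.symm j) : ℤˣ) : ℤ) : ℝ) * inner ℝ (f j) x ≤ 0)]
  refine forall_congr' fun i => ?_
  simp only [Equiv.symm_apply_apply, h, inner_smul_left, Units.val_mul, Int.cast_mul,
    conj_trivial]
  have h1 : ((s i : ℤ) : ℝ) * ((s i : ℤ) : ℝ) = 1 := by
    rcases Int.units_eq_one_or (s i) with h | h <;> simp [h]
  have : ((ε i : ℤ) : ℝ) * (c i * inner ℝ (f (σ i)) x) =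
      (((s i : ℤ) : ℝ) * c i) * (((ε i : ℤ) : ℝ) * ((s i : ℤ) : ℝ) * inner ℝ (f (σ i)) x) := by
    linear_combination (-((ε i : ℤ) : ℝ) * (c i * inner ℝ (f (σ i)) x)) * h1
  rw [this]
  constructor
  · intro h
    exact nonpos_of_mul_nonpos_right h (hs i)
  · intro h
    exact mul_nonpos_of_nonneg_of_nonpos (hs i).le h

theorem simplicesOf_eq_of_smul {f g : Fin n → Space n} (σ : Equiv.Perm (Fin n))
    (c : Fin n → ℝ) (hc : ∀ i, c i ≠ 0) (h : ∀ i, g i = c i • f (σ i)) :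
    simplicesOf g = simplicesOf f := by
  refine (simplicesOf_subset_of_smul σ c hc h).antisymm
    (simplicesOf_subset_of_smul σ.symm (fun i => (c (σ.symm i))⁻¹)
      (fun i => inv_ne_zero (hc _)) fun i => ?_)
  rw [h, smul_smul, inv_mul_cancel₀ (hc _), one_smul, Equiv.apply_symm_apply]

theorem image_simplex (T : Space n ≃ₗᵢ[ℝ] Space n) (f : Fin n → Space n) :
    T '' simplex f = simplex (fun i => T (f i)) := by
  ext x
  constructor
  · rintro ⟨y, ⟨h1, h2⟩, rfl⟩
    exact ⟨by simpa using h1, fun i => by simpa using h2 i⟩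
  · rintro ⟨h1, h2⟩
    refine ⟨T.symm x, ⟨by simpa using h1, fun i => ?_⟩, by simp⟩
    have := h2 i
    rwa [← T.inner_map_map, T.apply_symm_apply]

theorem image_simplicesOf (T : Space n ≃ₗᵢ[ℝ] Space n) (f : Fin n → Space n) :
    (fun P : Set (Space n) => T '' P) '' simplicesOf f = simplicesOf (fun i => T (f i)) := by
  ext P
  constructor
  · rintro ⟨_, ⟨ε, rfl⟩, rfl⟩
    refine ⟨ε, ?_⟩
    simp only [image_simplex, map_smul]
  · rintro ⟨ε, rfl⟩
    refine ⟨_, ⟨ε, rfl⟩, ?_⟩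
    simp only [image_simplex, map_smul]

/-- The points on the hyperplanes of a family are those that lie in two of its simplices. -/
theorem exists_inner_eq_zero_iff {f : Fin n → Space n} (hf : LinearIndependent ℝ f) {x : Space n}
    (hx : ‖x‖ = 1) :
    (∃ i, inner ℝ (f i) x = 0) ↔
      ∃ P ∈ simplicesOf f, ∃ Q ∈ simplicesOf f, P ≠ Q ∧ x ∈ P ∧ x ∈ Q := by
  constructor
  · rintro ⟨i, hi⟩
    choose ε hε using fun j => exists_units_mul_nonpos (inner ℝ (f j) x)
    refine ⟨_, ⟨ε, rfl⟩, _, ⟨Function.update ε i (-ε i), rfl⟩, ?_,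
      mem_simplex_units_smul.mpr ⟨hx, hε⟩, mem_simplex_units_smul.mpr ⟨hx, fun j => ?_⟩⟩
    -- After normalisation `y` lies in the interior of the first simplex and violates the flipped
    -- inequality, so the two simplices differ.
    · obtain ⟨y, hy⟩ := exists_inner_eq hf fun j => -((ε j : ℤ) : ℝ)
      have hsq : ∀ j, ((ε j : ℤ) : ℝ) * ((ε j : ℤ) : ℝ) = 1 := by
        intro j
        rcases Int.units_eq_one_or (ε j) with h | h <;> simp [h]
      have hy0 : y ≠ 0 := by
        rintro rfl
        have := hy i
        have := hsq i
        simp_all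
      have hpos : 0 < ‖y‖⁻¹ := by positivity
      intro heq
      have h1 : ‖y‖⁻¹ • y ∈ simplex (fun i => ((ε i : ℤ) : ℝ) • f i) := by
        rw [mem_simplex_units_smul]
        refine ⟨by simp [norm_smul, hy0], fun j => ?_⟩
        rw [inner_smul_right, hy]
        nlinarith [hsq j]
      rw [heq, mem_simplex_units_smul] at h1
      have h2 := h1.2 i
      rw [inner_smul_right, hy, Function.update_self] at h2
      push_cast at h2
      nlinarith [hsq i]
    · by_cases hj : j = i
      · subst hj
        simp [hi]
      · rw [Function.update_of_ne hj]
        exact hε j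
  -- At a point on no hyperplane all the inequalities are strict, and they determine the signs.
  · rintro ⟨_, ⟨ε, rfl⟩, _, ⟨ε', rfl⟩, hne, h1, h2⟩
    by_contra! h0
    apply hne
    congr 1
    ext1 i
    rw [mem_simplex_units_smul] at h1 h2
    have h1 := h1.2 i
    have h2 := h2.2 i
    have h0 := h0 i
    rcases Int.units_eq_one_or (ε i) with h | h <;> rcases Int.units_eq_one_or (ε' i) with h' | h' <;>
      rw [h] at h1 ⊢ <;> rw [h'] at h2 ⊢ <;> simp at h1 h2 <;> exact absurd (le_antisymm ‹_› ‹_›) (by first | exact h0 | exact h0.symm)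

/-- The normals of a family are determined up to order and scaling. -/
theorem exists_smul_of_simplicesOf_eq {f g : Fin n → Space n} (hf : LinearIndependent ℝ f)
    (hg : LinearIndependent ℝ g) (h : simplicesOf f = simplicesOf g) :
    ∃ (σ : Equiv.Perm (Fin n)) (c : Fin n → ℝ), (∀ i, c i ≠ 0) ∧ ∀ i, f i = c i • g (σ i) := by
  have key : ∀ i, ∃ (j : Fin n) (c : ℝ), c ≠ 0 ∧ c • f i = g j := by
    intro i
    let K := (ℝ ∙ f i)ᗮ
    -- Every point of the hyperplane of `f i` lies on some hyperplane of `g`. A real vector space is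
    -- not a finite union of proper subspaces, so a single `g j` serves the whole hyperplane.
    have hcover : ⋃ j, ((Submodule.comap K.subtype (ℝ ∙ g j)ᗮ : Submodule ℝ K) : Set K) =
        Set.univ := by
      refine Set.eq_univ_of_forall fun ⟨x, hx⟩ => ?_
      simp only [Set.mem_iUnion, SetLike.mem_coe, Submodule.mem_comap, Submodule.subtype_apply,
        Submodule.mem_orthogonal_singleton_iff_inner_right]
      by_cases hx0 : x = 0
      · exact ⟨i, by simp [hx0]⟩
      have hpos : ‖x‖⁻¹ ≠ 0 := by simpa using hx0
      have h1 : ‖‖x‖⁻¹ • x‖ = 1 := by simp [norm_smul, hx0]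
      have h2 : ∃ i, inner ℝ (f i) (‖x‖⁻¹ • x) = 0 :=
        ⟨i, by rw [inner_smul_right, Submodule.mem_orthogonal_singleton_iff_inner_right.mp hx,
          mul_zero]⟩
      rw [exists_inner_eq_zero_iff hf h1, h, ← exists_inner_eq_zero_iff hg h1] at h2
      obtain ⟨j, hj⟩ := h2
      rw [inner_smul_right, mul_eq_zero] at hj
      exact ⟨j, hj.resolve_left hpos⟩
    obtain ⟨j, hj⟩ := Subspace.exists_eq_top_of_iUnion_eq_univ hcover
    have hK : K ≤ (ℝ ∙ g j)ᗮ := fun x hx => by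
      have : (⟨x, hx⟩ : K) ∈ Submodule.comap K.subtype (ℝ ∙ g j)ᗮ := hj ▸ Submodule.mem_top
      exact this
    have hle := Submodule.orthogonal_le hK
    rw [Submodule.orthogonal_orthogonal, Submodule.orthogonal_orthogonal] at hle
    obtain ⟨c, hc⟩ := Submodule.mem_span_singleton.mp (hle (Submodule.mem_span_singleton_self _))
    refine ⟨j, c, ?_, hc⟩
    rintro rfl
    rw [zero_smul] at hc
    exact hg.ne_zero j hc.symm
  choose τ c hc hτ using key
  have hinj : Function.Injective τ := by
    intro i i' hii
    have := hf.units_smul (fun i => Units.mk0 (c i) (hc i))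
    apply this.injective
    simp only [Pi.smul_apply', Units.smul_mk0]
    rw [hτ, hτ, hii]
  refine ⟨Equiv.ofBijective τ (Finite.injective_iff_bijective.mp hinj), fun i => (c i)⁻¹,
    fun i => inv_ne_zero (hc i), fun i => ?_⟩
  rw [Equiv.ofBijective_apply, ← hτ, smul_smul, inv_mul_cancel₀ (hc i), one_smul]

theorem linearIndependent_map_isometry {f : Fin n → Space n} (hf : LinearIndependent ℝ f)
    (T : Space n ≃ₗᵢ[ℝ] Space n) : LinearIndependent ℝ fun i => T (f i) :=
  hf.map' T.toLinearEquiv.toLinearMap (LinearEquiv.ker _)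

/-- Two families are isometric if and only if an isometry takes the normals of the first to
multiples of the normals of the second. -/
theorem familyIsometric_simplicesOf_iff {f g : Fin n → Space n} (hf : LinearIndependent ℝ f)
    (hg : LinearIndependent ℝ g) :
    FamilyIsometric (simplicesOf f) (simplicesOf g) ↔
      ∃ (T : Space n ≃ₗᵢ[ℝ] Space n) (σ : Equiv.Perm (Fin n)) (c : Fin n → ℝ),
        (∀ i, c i ≠ 0) ∧ ∀ i, T (f i) = c i • g (σ i) := by
  constructor
  · rintro ⟨T, hT⟩
    rw [image_simplicesOf] at hT
    exact ⟨T, exists_smul_of_simplicesOf_eq (linearIndependent_map_isometry hf T) hg hT⟩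
  · rintro ⟨T, σ, c, hc, h⟩
    exact ⟨T, by rw [image_simplicesOf]; exact simplicesOf_eq_of_smul σ c hc h⟩

end Families

/-! ### Roots as signed edges -/

section Roots

variable {n : ℕ}

/-- The standard basis vector. -/
noncomputable abbrev stdVec (x : Fin n) : Space n := EuclideanSpace.single x (1 : ℝ)

theorem isRootOn_iff {v : Space n} {x y : Fin n} :
    IsRootOn v x y ↔ ∃ s t : ℝ, s * s = 1 ∧ t * t = 1 ∧ v = s • stdVec x + t • stdVec y := by
  constructor
  · rintro ⟨s, t, rfl⟩
    refine ⟨_, _, ?_, ?_, rfl⟩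
    · rcases Int.units_eq_one_or s with rfl | rfl <;> simp
    · rcases Int.units_eq_one_or t with rfl | rfl <;> simp
  · have key : ∀ s : ℝ, s * s = 1 → ∃ u : ℤˣ, ((u : ℤ) : ℝ) = s := by
      intro s hs
      rcases mul_self_eq_one_iff.mp hs with rfl | rfl
      · exact ⟨1, by simp⟩
      · exact ⟨-1, by simp⟩
    rintro ⟨s, t, hs, ht, rfl⟩
    obtain ⟨s, rfl⟩ := key s hs
    obtain ⟨t, rfl⟩ := key t ht
    exact ⟨s, t, rfl⟩

theorem inner_stdVec_left (x : Fin n) (v : Space n) : inner ℝ (stdVec x) v = v x := by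
  rw [EuclideanSpace.inner_single_left, map_one, one_mul]

theorem inner_add_smul_stdVec (s t : ℝ) (x y : Fin n) (v : Space n) :
    inner ℝ (s • stdVec x + t • stdVec y) v = s * v x + t * v y := by
  rw [inner_add_left, inner_smul_left, inner_smul_left, inner_stdVec_left, inner_stdVec_left]
  rfl

theorem smul_stdVec_add_apply_left {s t : ℝ} {x y : Fin n} (h : x ≠ y) :
    (s • stdVec x + t • stdVec y) x = s := by
  simp [h]

theorem smul_stdVec_add_apply_right {s t : ℝ} {x y : Fin n} (h : x ≠ y) :
    (s • stdVec x + t • stdVec y) y = t := by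
  simp [h.symm]

theorem smul_stdVec_add_apply_of_ne {s t : ℝ} {x y z : Fin n} (hx : z ≠ x) (hy : z ≠ y) :
    (s • stdVec x + t • stdVec y) z = 0 := by
  simp [hx, hy]

theorem inner_self_of_mem_rootsD {r : Space n} (hr : r ∈ rootsD n) : inner ℝ r r = 2 := by
  obtain ⟨x, y, hxy, h⟩ := hr
  obtain ⟨s, t, hs, ht, rfl⟩ := isRootOn_iff.mp h
  rw [inner_add_smul_stdVec, smul_stdVec_add_apply_left hxy, smul_stdVec_add_apply_right hxy, hs,
    ht]
  norm_num

/-- The set `R` contains the root `h x - e h y`, for the sign `e`. -/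
def HasGain (R : Set (Space n)) (x y : Fin n) (e : ℝ) : Prop :=
  e * e = 1 ∧ stdVec x - e • stdVec y ∈ R

/-! ### Sets closed under the reflections in their elements -/

section Closed

variable {R : Set (Space n)} (hR : ∀ r ∈ R, ∀ r' ∈ R, r' - inner ℝ r r' • r ∈ R)
include hR

theorem neg_mem_of_closed {r : Space n} (h : r ∈ R) (hr : r ∈ rootsD n) : -r ∈ R := by
  have := hR r h r h
  rw [inner_self_of_mem_rootsD hr] at this
  convert this using 1
  module

theorem smul_mem_of_closed {r : Space n} (h : r ∈ R) (hr : r ∈ rootsD n) {s : ℝ}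
    (hs : s * s = 1) : s • r ∈ R := by
  rcases mul_self_eq_one_iff.mp hs with rfl | rfl
  · simpa
  · simpa using neg_mem_of_closed hR h hr

theorem hasGain_of_mem {x y : Fin n} (hxy : x ≠ y) {s t : ℝ} (hs : s * s = 1) (ht : t * t = 1)
    (h : s • stdVec x + t • stdVec y ∈ R) : HasGain R x y (-(s * t)) := by
  refine ⟨by linear_combination s * s * ht + hs, ?_⟩
  have := smul_mem_of_closed hR h ⟨x, y, hxy, isRootOn_iff.mpr ⟨s, t, hs, ht, rfl⟩⟩ hs
  convert this using 1
  rw [smul_add, smul_smul, smul_smul, hs]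
  module

theorem mem_of_hasGain {x y : Fin n} (hxy : x ≠ y) {s t : ℝ} (hs : s * s = 1) (ht : t * t = 1)
    (h : HasGain R x y (-(s * t))) : s • stdVec x + t • stdVec y ∈ R := by
  have := smul_mem_of_closed hR h.2 ⟨x, y, hxy, isRootOn_iff.mpr
    ⟨1, s * t, by simp, by linear_combination s * s * ht + hs, by module⟩⟩ hs
  convert this using 1
  have h3 : (s * s) • stdVec y = stdVec y := by rw [hs, one_smul]
  calc s • stdVec x + t • stdVec y = s • stdVec x + t • (s * s) • stdVec y := by rw [h3]
    _ = _ := by module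

theorem HasGain.symm_of_closed {x y : Fin n} (hxy : x ≠ y) {e : ℝ} (h : HasGain R x y e) :
    HasGain R y x e := by
  obtain ⟨he, h⟩ := h
  have := hasGain_of_mem hR (s := -e) (t := 1) hxy.symm (by linarith) (by simp)
    (by convert h using 1; module)
  simpa using this

/-- Reflecting `h y - e' h z` in the hyperplane of `h x - e h y` gives `e (h x - e e' h z)`, so
signs multiply along paths. -/
theorem HasGain.trans_of_closed {x y z : Fin n} (hxy : x ≠ y) (hyz : y ≠ z) (hxz : x ≠ z)
    {e e' : ℝ} (h : HasGain R x y e) (h' : HasGain R y z e') : HasGain R x z (e * e') := by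
  have h1 := hR _ h.2 _ h'.2
  have h2 : inner ℝ (stdVec x - e • stdVec y) (stdVec y - e' • stdVec z : Space n) = -e := by
    have := inner_add_smul_stdVec 1 (-e) x y (stdVec y - e' • stdVec z)
    rw [one_smul, neg_smul, ← sub_eq_add_neg] at this
    rw [this]
    simp [hxy, hyz, hxz]
  rw [h2] at h1
  have := hasGain_of_mem hR (s := e) (t := -e') hxz h.1 (by linarith [h'.1]) (by
    convert h1 using 1
    have h3 : (e * e) • stdVec y = stdVec y := by rw [h.1, one_smul]
    calc e • stdVec x + -e' • stdVec z = stdVec y - e' • stdVec z + e • stdVec x - stdVec y := by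
          module
      _ = stdVec y - e' • stdVec z + e • stdVec x - (e * e) • stdVec y := by rw [h3]
      _ = _ := by module)
  simpa using this

/-- A set of roots that is closed under reflections and contains linearly independent roots
whose graph is connected contains all roots. -/
theorem rootsD_subset_of_closed {f : Fin n → Space n} (hf : LinearIndependent ℝ f)
    (hroot : ∀ k, f k ∈ rootsD n) (hc : IsConnected (graphOf f)) (hfR : ∀ k, f k ∈ R) :
    rootsD n ⊆ R := by
  have hlink : ∀ k x y, x ≠ y → IsRootOn (f k) x y → ∃ s t : ℝ, s * s = 1 ∧ t * t = 1 ∧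
      f k = s • stdVec x + t • stdVec y ∧ HasGain R x y (-(s * t)) := by
    intro k x y hxy h
    obtain ⟨s, t, hs, ht, hk⟩ := isRootOn_iff.mp h
    exact ⟨s, t, hs, ht, hk, hasGain_of_mem hR hxy hs ht (hk ▸ hfR k)⟩
  have hall : ∀ x y, x ≠ y → ∃ e, HasGain R x y e := by
    intro x y
    induction hc.2 x trivial y trivial with
    | refl => exact fun h => absurd rfl h
    | @tail y z _ hyz ih =>
      intro hxz
      obtain ⟨k, hyz, hk⟩ := hyz
      obtain ⟨s, t, -, -, -, hg⟩ := hlink k y z hyz hk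
      by_cases hxy : x = y
      · subst hxy
        exact ⟨_, hg⟩
      · obtain ⟨e, he⟩ := ih hxy
        exact ⟨_, he.trans_of_closed hR hxy hyz hxz hg⟩
  -- If every pair had only one sign, the signs seen from a fixed vertex `x₀` would form a nonzero
  -- vector orthogonal to all `f k`, against independence.
  have hboth : ∃ x y, x ≠ y ∧ HasGain R x y 1 ∧ HasGain R x y (-1) := by
    by_contra! hno
    have huniq : ∀ x y, x ≠ y → ∀ e e', HasGain R x y e → HasGain R x y e' → e = e' := by
      intro x y hxy e e' h h'
      rcases mul_self_eq_one_iff.mp h.1 with rfl | rfl <;>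
        rcases mul_self_eq_one_iff.mp h'.1 with rfl | rfl
      · rfl
      · exact absurd h' (hno x y hxy h)
      · exact absurd h (hno x y hxy h')
      · rfl
    obtain ⟨x₀, -⟩ := hc.1
    have hex : ∀ x, ∃ e : ℝ, e * e = 1 ∧ (x = x₀ → e = 1) ∧ (x₀ ≠ x → HasGain R x₀ x e) := by
      intro x
      by_cases hx : x = x₀
      · exact ⟨1, by simp, fun _ => rfl, fun h => absurd hx.symm h⟩
      · obtain ⟨e, he⟩ := hall x₀ x (Ne.symm hx)
        exact ⟨e, he.1, fun h => absurd h hx, fun _ => he⟩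
    choose ε hε hε₀ hεg using hex
    have hu : WithLp.toLp 2 ε = (0 : Space n) := by
      refine inner_left_injective hf fun k => ?_
      obtain ⟨x, y, hxy, hk⟩ := hroot k
      obtain ⟨s, t, hs, ht, hk, hg⟩ := hlink k x y hxy hk
      have hst : ε x * ε y = -(s * t) := by
        by_cases hx : x = x₀
        · rw [hε₀ x hx, one_mul]
          subst hx
          exact huniq _ _ hxy _ _ (hεg y hxy) hg
        by_cases hy : y = x₀
        · rw [hε₀ y hy, mul_one]
          subst hy
          exact huniq _ _ hxy _ _ ((hεg x (Ne.symm hx)).symm_of_closed hR (Ne.symm hx)) hg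
        · exact huniq _ _ hxy _ _ (((hεg x (Ne.symm hx)).symm_of_closed hR
            (Ne.symm hx)).trans_of_closed hR hx (Ne.symm hy) hxy (hεg y (Ne.symm hy))) hg
      rw [hk, inner_add_smul_stdVec]
      change s * ε x + t * ε y = 0
      linear_combination -(s * ε x) * hε y + s * ε y * hst - t * ε y * hs
    have : ε x₀ = 0 := congrArg (fun v : Space n => v x₀) hu
    have := hε x₀
    simp_all
  obtain ⟨p, q, hpq, h1, h2⟩ := hboth
  let Both : Fin n → Fin n → Prop := fun x y => HasGain R x y 1 ∧ HasGain R x y (-1)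
  have hsymm : ∀ x y, x ≠ y → Both x y → Both y x := fun x y hxy h =>
    ⟨h.1.symm_of_closed hR hxy, h.2.symm_of_closed hR hxy⟩
  -- Composing both signs between `x` and `y` with any one sign between `y` and `z` yields both
  -- signs between `x` and `z`.
  have hstep : ∀ x y z, x ≠ y → x ≠ z → Both x y → Both x z := by
    intro x y z hxy hxz h
    by_cases hyz : y = z
    · rwa [← hyz]
    obtain ⟨e, he⟩ := hall y z hyz
    have h1 := h.1.trans_of_closed hR hxy hyz hxz he
    have h2 := h.2.trans_of_closed hR hxy hyz hxz he
    rcases mul_self_eq_one_iff.mp he.1 with rfl | rfl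
    · simp only [mul_one] at h1 h2
      exact ⟨h1, h2⟩
    · simp only [mul_neg, mul_one, neg_neg] at h1 h2
      exact ⟨h2, h1⟩
  have hallboth : ∀ x y, x ≠ y → Both x y := by
    intro x y hxy
    by_cases hpx : p = x
    · subst hpx
      exact hstep p q y hpq hxy ⟨h1, h2⟩
    · exact hstep x p y (Ne.symm hpx) hxy (hsymm p x hpx (hstep p q x hpq hpx ⟨h1, h2⟩))
  rintro r ⟨x, y, hxy, hr⟩
  obtain ⟨s, t, hs, ht, rfl⟩ := isRootOn_iff.mp hr
  refine mem_of_hasGain hR hxy hs ht ?_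
  have hst : -(s * t) * -(s * t) = 1 := by linear_combination s * s * ht + hs
  rcases mul_self_eq_one_iff.mp hst with h | h <;> rw [h]
  · exact (hallboth x y hxy).1
  · exact (hallboth x y hxy).2

end Closed

end Roots

/-! ### The reflection group of `D n` and its reflections -/

section Reflections

variable {n : ℕ}

theorem reflection_orthogonal_singleton_apply (v w : Space n) :
    (ℝ ∙ v)ᗮ.reflection w = w - (2 * inner ℝ v w / inner ℝ v v) • v := by
  rw [Submodule.reflection_orthogonal_apply, Submodule.reflection_singleton_apply,
    real_inner_self_eq_norm_sq, RCLike.ofReal_real_eq_id, id]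
  module

theorem reflection_apply_of_inner_self {r : Space n} (hr : inner ℝ r r = 2) (w : Space n) :
    (ℝ ∙ r)ᗮ.reflection w = w - inner ℝ r w • r := by
  rw [reflection_orthogonal_singleton_apply, hr]
  congr 2
  ring

theorem reflection_smul {c : ℝ} (hc : c ≠ 0) (v : Space n) :
    (ℝ ∙ (c • v))ᗮ.reflection = (ℝ ∙ v)ᗮ.reflection := by
  congr 2
  exact Submodule.span_singleton_smul_eq (IsUnit.mk0 c hc) v

theorem conj_reflection (T : Space n ≃ₗᵢ[ℝ] Space n) (v : Space n) :
    T * (ℝ ∙ v)ᗮ.reflection * T⁻¹ = (ℝ ∙ T v)ᗮ.reflection := by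
  ext1 x
  change T ((ℝ ∙ v)ᗮ.reflection (T.symm x)) = _
  rw [reflection_orthogonal_singleton_apply, reflection_orthogonal_singleton_apply, map_sub,
    map_smul, T.inner_map_map, T.apply_symm_apply]
  congr 4
  rw [← T.inner_map_map, T.apply_symm_apply]

theorem map_conj_reflectionGroup (T : Space n ≃ₗᵢ[ℝ] Space n) (f : Fin n → Space n) :
    (reflectionGroup (Set.range f)).map (MulAut.conj T).toMonoidHom =
      reflectionGroup (Set.range fun i => T (f i)) := by
  rw [reflectionGroup, reflectionGroup, MonoidHom.map_closure, ← Set.range_comp, ← Set.range_comp,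
    ← Set.range_comp]
  congr 2
  ext1 i
  exact conj_reflection T (f i)

theorem reflection_mem_reflectionGroup {A : Set (Space n)} {v : Space n} (hv : v ∈ A) :
    (ℝ ∙ v)ᗮ.reflection ∈ reflectionGroup A :=
  Subgroup.subset_closure ⟨v, hv, rfl⟩

theorem reflectionGroup_smul {f : Fin n → Space n} {c : Fin n → ℝ} (hc : ∀ i, c i ≠ 0) :
    reflectionGroup (Set.range fun i => c i • f i) = reflectionGroup (Set.range f) := by
  rw [reflectionGroup, reflectionGroup, ← Set.range_comp, ← Set.range_comp]
  congr 2
  ext1 i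
  exact reflection_smul (hc i) (f i)

/-- A set invariant under the generating reflections is invariant under the group. -/
theorem mem_iff_of_mem_reflectionGroup {A Q : Set (Space n)}
    (hQ : ∀ v ∈ A, ∀ w ∈ Q, (ℝ ∙ v)ᗮ.reflection w ∈ Q) {g : Space n ≃ₗᵢ[ℝ] Space n}
    (hg : g ∈ reflectionGroup A) (w : Space n) : g w ∈ Q ↔ w ∈ Q := by
  induction hg using Subgroup.closure_induction generalizing w with
  | mem g hg =>
    obtain ⟨v, hv, rfl⟩ := hg
    refine ⟨fun h => ?_, hQ v hv w⟩
    have := hQ v hv _ h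
    rwa [Submodule.reflection_reflection] at this
  | one => rfl
  | mul g g' _ _ h h' => exact (h (g' w)).trans (h' w)
  | inv g _ h =>
    rw [← h]
    change g (g.symm w) ∈ Q ↔ _
    rw [g.apply_symm_apply]

/-- Linearly independent roots with a connected graph generate the reflection group of `D n`. -/
theorem reflectionGroup_eq_of_isConnected {f : Fin n → Space n} (hf : LinearIndependent ℝ f)
    (hroot : ∀ k, f k ∈ rootsD n) (hc : IsConnected (graphOf f)) :
    reflectionGroup (Set.range f) = reflectionGroup (rootsD n) := by
  let R : Set (Space n) :=
    {r | inner ℝ r r = 2 ∧ (ℝ ∙ r)ᗮ.reflection ∈ reflectionGroup (Set.range f)}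
  -- The reflection belonging to the image of `r'` is the conjugate of that of `r'` by that of `r`.
  have hR : ∀ r ∈ R, ∀ r' ∈ R, r' - inner ℝ r r' • r ∈ R := by
    rintro r ⟨hr, h⟩ r' ⟨hr', h'⟩
    rw [← reflection_apply_of_inner_self hr]
    refine ⟨by rw [LinearIsometryEquiv.inner_map_map, hr'], ?_⟩
    rw [← conj_reflection]
    exact mul_mem (mul_mem h h') (inv_mem h)
  have hsub := rootsD_subset_of_closed hR hf hroot hc fun k =>
    ⟨inner_self_of_mem_rootsD (hroot k), reflection_mem_reflectionGroup ⟨k, rfl⟩⟩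
  apply le_antisymm
  · rw [reflectionGroup, Subgroup.closure_le]
    rintro _ ⟨_, ⟨k, rfl⟩, rfl⟩
    exact reflection_mem_reflectionGroup (hroot k)
  · rw [reflectionGroup, Subgroup.closure_le]
    rintro _ ⟨r, hr, rfl⟩
    exact (hsub hr).2

theorem reflection_root_apply {s t : ℝ} (hs : s * s = 1) (ht : t * t = 1) {x y : Fin n}
    (hxy : x ≠ y) (w : Space n) :
    (ℝ ∙ (s • stdVec x + t • stdVec y))ᗮ.reflection w =
      w - (s * w x + t * w y) • (s • stdVec x + t • stdVec y) := by
  rw [reflection_apply_of_inner_self, inner_add_smul_stdVec]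
  exact inner_self_of_mem_rootsD ⟨x, y, hxy, isRootOn_iff.mpr ⟨s, t, hs, ht, rfl⟩⟩

/-- The reflection group of `D n` permutes the vectors `± h x`. -/
theorem exists_eq_smul_stdVec_of_mem {g : Space n ≃ₗᵢ[ℝ] Space n}
    (hg : g ∈ reflectionGroup (rootsD n)) (x : Fin n) :
    ∃ (y : Fin n) (e : ℝ), e * e = 1 ∧ g (stdVec x) = e • stdVec y := by
  let Q : Set (Space n) := {w | ∃ (y : Fin n) (e : ℝ), e * e = 1 ∧ w = e • stdVec y}
  have hQ : ∀ v ∈ rootsD n, ∀ w ∈ Q, (ℝ ∙ v)ᗮ.reflection w ∈ Q := by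
    rintro v ⟨p, q, hpq, hv⟩ _ ⟨z, e, he, rfl⟩
    obtain ⟨s, t, hs, ht, rfl⟩ := isRootOn_iff.mp hv
    have hst : -(s * t) * -(s * t) = 1 := by linear_combination s * s * ht + hs
    rw [map_smul, reflection_root_apply hs ht hpq]
    by_cases h1 : z = p
    · subst h1
      refine ⟨q, -(s * t) * e, by linear_combination e * e * hst + he, ?_⟩
      have h2 : stdVec z q = 0 := by simp [hpq.symm]
      have h3 : stdVec z z = 1 := by simp
      have h4 : (s * s) • stdVec z = stdVec z := by rw [hs, one_smul]
      rw [h2, h3]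
      calc _ = e • (stdVec z - (s * s) • stdVec z - (s * t) • stdVec q) := by module
        _ = _ := by rw [h4]; module
    by_cases h1' : z = q
    · subst h1'
      refine ⟨p, -(s * t) * e, by linear_combination e * e * hst + he, ?_⟩
      have h2 : stdVec z p = 0 := by simp [hpq]
      have h3 : stdVec z z = 1 := by simp
      have h4 : (t * t) • stdVec z = stdVec z := by rw [ht, one_smul]
      rw [h2, h3]
      calc _ = e • (stdVec z - (t * t) • stdVec z - (s * t) • stdVec p) := by module
        _ = _ := by rw [h4]; module
    · refine ⟨z, e, he, ?_⟩
      have h2 : stdVec z p = 0 := by simp [Ne.symm h1]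
      have h3 : stdVec z q = 0 := by simp [Ne.symm h1']
      rw [h2, h3]
      module
  exact (mem_iff_of_mem_reflectionGroup hQ hg (stdVec x)).mpr ⟨x, 1, by simp, by simp⟩

/-- The reflections in the hyperplanes orthogonal to the `h x` do not belong to the reflection
group of `D n`. -/
theorem reflection_stdVec_notMem (x : Fin n) :
    (ℝ ∙ stdVec x)ᗮ.reflection ∉ reflectionGroup (rootsD n) := by
  intro hg
  -- The translate by `(1/2, …, 1/2)` of the integral vectors with even sum. On it a reflection in a
  -- root subtracts an integral multiple of that root, whereas reversing one coordinate of `(1/2, …,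
  -- 1/2)` subtracts `h x`, whose sum is odd.
  let Q : Set (Space n) := {w | ∃ z : Fin n → ℤ, Even (∑ y, z y) ∧ ∀ y, w y = 1 / 2 + z y}
  have hQ : ∀ v ∈ rootsD n, ∀ w ∈ Q, (ℝ ∙ v)ᗮ.reflection w ∈ Q := by
    rintro v ⟨p, q, hpq, s, t, rfl⟩ w ⟨z, hz, hw⟩
    have hs : ((s : ℤ) : ℝ) * ((s : ℤ) : ℝ) = 1 := by
      rcases Int.units_eq_one_or s with h | h <;> simp [h]
    have ht : ((t : ℤ) : ℝ) * ((t : ℤ) : ℝ) = 1 := by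
      rcases Int.units_eq_one_or t with h | h <;> simp [h]
    obtain ⟨m, hm⟩ : ∃ m : ℤ, ((s : ℤ) : ℝ) * w p + ((t : ℤ) : ℝ) * w q = m := by
      rw [hw, hw]
      rcases Int.units_eq_one_or s with rfl | rfl <;> rcases Int.units_eq_one_or t with rfl | rfl
      · exact ⟨1 + z p + z q, by push_cast; ring⟩
      · exact ⟨z p - z q, by push_cast; ring⟩
      · exact ⟨z q - z p, by push_cast; ring⟩
      · exact ⟨-(1 + z p + z q), by push_cast; ring⟩
    rw [reflection_root_apply hs ht hpq, hm]
    refine ⟨fun y => z y - m * ((Pi.single p (s : ℤ) : Fin n → ℤ) y + (Pi.single q (t : ℤ) : Fin n → ℤ) y), ?_, ?_⟩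
    · rw [Finset.sum_sub_distrib, ← Finset.mul_sum, Finset.sum_add_distrib, Finset.sum_pi_single',
        Finset.sum_pi_single']
      refine hz.sub (Even.mul_left ?_ m)
      rcases Int.units_eq_one_or s with rfl | rfl <;>
        rcases Int.units_eq_one_or t with rfl | rfl <;> simp
    · intro y
      simp only [PiLp.sub_apply, PiLp.smul_apply, PiLp.add_apply, smul_eq_mul, hw,
        PiLp.single_apply, Pi.single_apply]
      push_cast
      split_ifs <;> ring
  obtain ⟨z, hz, hw⟩ := (mem_iff_of_mem_reflectionGroup hQ hg (WithLp.toLp 2 fun _ => 1 / 2)).mpr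
    ⟨0, by simp, by simp⟩
  have hz' : z = -Pi.single x 1 := by
    ext y
    have := hw y
    rw [reflection_orthogonal_singleton_apply, inner_stdVec_left, inner_stdVec_left] at this
    by_cases hyx : y = x
    · subst hyx
      simp at this
      rw [Pi.neg_apply, Pi.single_eq_same]
      have : (z y : ℝ) = ((-1 : ℤ) : ℝ) := by push_cast; linarith
      exact_mod_cast this
    · simp [hyx] at this
      simpa [hyx] using this
  rw [hz'] at hz
  simp at hz

/-- The only reflections in the reflection group of `D n` are those in the hyperplanes orthogonal
to its roots. -/
theorem exists_smul_root_of_reflection_mem {v : Space n} (hv : v ≠ 0)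
    (h : (ℝ ∙ v)ᗮ.reflection ∈ reflectionGroup (rootsD n)) :
    ∃ (c : ℝ) (r : Space n), c ≠ 0 ∧ r ∈ rootsD n ∧ v = c • r := by
  obtain ⟨x, hx⟩ : ∃ x, v x ≠ 0 := by
    by_contra! h0
    exact hv (by ext x; simpa using h0 x)
  -- As `v x ≠ 0`, the reflection moves `h x`, and the displacement `h x - e h y` is a nonzero
  -- multiple of `v`.
  obtain ⟨y, e, he, hy⟩ := exists_eq_smul_stdVec_of_mem h x
  rw [reflection_orthogonal_singleton_apply, real_inner_comm, inner_stdVec_left] at hy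
  have hvv : inner ℝ v v ≠ 0 := by simpa using hv
  set a := 2 * v x / inner ℝ v v with ha
  have ha0 : a ≠ 0 := div_ne_zero (mul_ne_zero two_ne_zero hx) hvv
  have hav : a • v = stdVec x - e • stdVec y := by
    rw [← hy]
    module
  have hva : v = a⁻¹ • (stdVec x - e • stdVec y) := by
    rw [← hav, smul_smul, inv_mul_cancel₀ ha0, one_smul]
  -- For `x = y` the vector `v` is zero or parallel to `h x`, which parity excludes; for `x ≠ y` the
  -- displacement is itself a root.
  by_cases hxy : x = y
  · subst hxy
    exfalso
    rcases mul_self_eq_one_iff.mp he with rfl | rfl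
    · apply hv
      rw [hva]
      simp
    · have h2 : v = (a⁻¹ * 2) • stdVec x := by
        rw [hva]
        module
      rw [h2, reflection_smul (mul_ne_zero (inv_ne_zero ha0) two_ne_zero)] at h
      exact reflection_stdVec_notMem x h
  · refine ⟨a⁻¹, _, inv_ne_zero ha0, ⟨x, y, hxy, isRootOn_iff.mpr
      ⟨1, -e, by simp, by linarith, rfl⟩⟩, ?_⟩
    rw [hva]
    module

/-- Roots that generate the reflection group of `D n` have a connected graph. -/
theorem isConnected_of_reflectionGroup_eq [NeZero n] {f : Fin n → Space n}
    (hroot : ∀ k, f k ∈ rootsD n)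
    (h : reflectionGroup (Set.range f) = reflectionGroup (rootsD n)) :
    IsConnected (graphOf f) := by
  refine ⟨⟨0, trivial⟩, fun x _ y _ => ?_⟩
  by_cases hxy : x = y
  · subst hxy
    exact Relation.ReflTransGen.refl
  by_contra hnot
  -- The vectors supported on the component of `x` are preserved by the generators, but the
  -- reflection in `h x - h y` sends `h x` to `h y`.
  let Q : Set (Space n) := {w | ∀ z, ¬ Relation.ReflTransGen (graphOf f).Adj x z → w z = 0}
  have hQ : ∀ v ∈ Set.range f, ∀ w ∈ Q, (ℝ ∙ v)ᗮ.reflection w ∈ Q := by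
    rintro _ ⟨k, rfl⟩ w hw z hz
    obtain ⟨p, q, hpq, hk⟩ := hroot k
    have hadj : (graphOf f).Adj p q := ⟨k, hpq, hk⟩
    obtain ⟨s, t, hs, ht, hk⟩ := isRootOn_iff.mp hk
    rw [hk, reflection_root_apply hs ht hpq]
    by_cases hp : Relation.ReflTransGen (graphOf f).Adj x p
    · have hzp : z ≠ p := by
        rintro rfl
        exact hz hp
      have hzq : z ≠ q := by
        rintro rfl
        exact hz (hp.tail hadj)
      rw [PiLp.sub_apply, PiLp.smul_apply, smul_stdVec_add_apply_of_ne hzp hzq, hw z hz]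
      simp
    · have hq : ¬ Relation.ReflTransGen (graphOf f).Adj x q := fun hq => hp (hq.tail hadj.symm)
      rw [hw p hp, hw q hq, PiLp.sub_apply, hw z hz]
      simp
  have hg : (ℝ ∙ ((1 : ℝ) • stdVec x + (-1 : ℝ) • stdVec y))ᗮ.reflection ∈
      reflectionGroup (Set.range f) := by
    rw [h]
    exact reflection_mem_reflectionGroup
      ⟨x, y, hxy, isRootOn_iff.mpr ⟨1, -1, by simp, by simp, rfl⟩⟩
  have hx : stdVec x ∈ Q := by
    intro z hz
    have : z ≠ x := by
      rintro rfl
      exact hz Relation.ReflTransGen.refl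
    simp [this]
  have := (mem_iff_of_mem_reflectionGroup hQ hg _).mpr hx y hnot
  rw [reflection_root_apply (by simp) (by simp) hxy] at this
  simp [Ne.symm hxy] at this

end Reflections

/-! ### Signs on a unicyclic graph up to switching -/

section GraphsOfRoots

variable {n : ℕ}

theorem graphOf_eq_ofEnds {f : Fin n → Space n} {a : Fin n → Sym2 (Fin n)} :
    graphOf f = ofEnds a ↔ ∀ k x y, a k = s(x, y) ↔ x ≠ y ∧ IsRootOn (f k) x y := by
  constructor
  · intro h k x y
    rw [← ofEnds_isLink (a := a), ← h]
    rfl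
  · intro h
    exact Graph.ext rfl fun k x y => (h k x y).symm

theorem isRootOn_iff_of_isRootOn {v : Space n} {p q x y : Fin n} (hpq : p ≠ q)
    (h : IsRootOn v p q) : s(p, q) = s(x, y) ↔ x ≠ y ∧ IsRootOn v x y := by
  constructor
  · intro hs
    rcases Sym2.eq_iff.mp hs with ⟨rfl, rfl⟩ | ⟨rfl, rfl⟩
    · exact ⟨hpq, h⟩
    · obtain ⟨s, t, h⟩ := h
      exact ⟨hpq.symm, t, s, h.trans (add_comm _ _)⟩
  · rintro ⟨hxy, h'⟩
    have key := fun z => (isRootOn_apply_ne_zero hpq h z).symm.trans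
      (isRootOn_apply_ne_zero hxy h' z)
    have hp := (key p).mp (Or.inl rfl)
    have hq := (key q).mp (Or.inr rfl)
    rw [Sym2.eq_iff]
    grind

theorem graphOf_eq_ofEnds_of_isRootOn {f : Fin n → Space n} {p q : Fin n → Fin n}
    (hpq : ∀ k, p k ≠ q k) (h : ∀ k, IsRootOn (f k) (p k) (q k)) :
    graphOf f = ofEnds fun k => s(p k, q k) :=
  graphOf_eq_ofEnds.mpr fun k _ _ => isRootOn_iff_of_isRootOn (hpq k) (h k)

theorem exists_graphOf_eq_ofEnds {f : Fin n → Space n} (hroot : ∀ k, f k ∈ rootsD n) :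
    ∃ a, graphOf f = ofEnds a := by
  choose p q hpq h using hroot
  exact ⟨_, graphOf_eq_ofEnds_of_isRootOn hpq h⟩

theorem graphOf_loopless (f : Fin n → Space n) : (graphOf f).Loopless :=
  ⟨fun _ _ h => h.1 rfl⟩

theorem isUnicyclic_graphOf {f : Fin n → Space n} (hroot : ∀ k, f k ∈ rootsD n)
    (h : IsConnected (graphOf f)) : IsUnicyclic (graphOf f) := by
  have hl := graphOf_loopless f
  obtain ⟨a, ha⟩ := exists_graphOf_eq_ofEnds hroot
  rw [ha] at h hl ⊢
  exact isUnicyclic_ofEnds_iff.mpr ⟨h, hl, rfl⟩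

theorem exists_isometry_smul_stdVec {ε : Fin n → ℝ} (hε : ∀ x, ε x * ε x = 1) :
    ∃ T : Space n ≃ₗᵢ[ℝ] Space n, ∀ x, T (stdVec x) = ε x • stdVec x := by
  have h : ∀ x, ∃ e : ℝ ≃ₗᵢ[ℝ] ℝ, e 1 = ε x := by
    intro x
    rcases mul_self_eq_one_iff.mp (hε x) with h | h
    · exact ⟨.refl ℝ ℝ, by simp [h]⟩
    · exact ⟨.neg ℝ, by simp [h]⟩
  choose e he using h
  refine ⟨LinearIsometryEquiv.piLpCongrRight 2 e, fun x => ?_⟩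
  ext y
  by_cases hy : y = x
  · subst hy
    simp [he]
  · simp [hy]

/-- The roots of the edges of a graph, with the signs of a balanced graph except at the edge
`k₀`. -/
noncomputable def almostBalancedRoots (p q : Fin n → Fin n) (k₀ k : Fin n) : Space n :=
  if k = k₀ then stdVec (p k) + stdVec (q k) else stdVec (p k) - stdVec (q k)

variable {p q : Fin n → Fin n} {k₀ : Fin n}

theorem isRootOn_almostBalancedRoots (k : Fin n) :
    IsRootOn (almostBalancedRoots p q k₀ k) (p k) (q k) := by
  rw [isRootOn_iff, almostBalancedRoots]
  split_ifs
  · exact ⟨1, 1, by simp, by simp, by module⟩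
  · exact ⟨1, -1, by simp, by simp, by module⟩

variable (hc : IsConnected (ofEnds fun k : {k // k ≠ k₀} => s(p k.1, q k.1)))
include hc

/-- Orthogonality to the edges other than `k₀` makes a vector constant on the connected remainder;
orthogonality to the edge `k₀` then makes the constant zero. -/
theorem linearIndependent_almostBalancedRoots :
    LinearIndependent ℝ (almostBalancedRoots p q k₀) := by
  refine linearIndependent_of_inner_left_injective fun x hx => ?_
  have hconst : ∀ y z, x y = x z := by
    refine hc.eq_of_forall_link x ?_
    rintro ⟨k, hk⟩ y z hyz
    have := hx k
    rw [almostBalancedRoots, if_neg hk, inner_sub_left, inner_stdVec_left, inner_stdVec_left] at this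
    rcases Sym2.eq_iff.mp hyz with ⟨rfl, rfl⟩ | ⟨rfl, rfl⟩ <;> linarith
  have h0 := hx k₀
  rw [almostBalancedRoots, if_pos rfl, inner_add_left, inner_stdVec_left, inner_stdVec_left,
    hconst (q k₀) (p k₀)] at h0
  ext y
  rw [hconst y (p k₀), PiLp.zero_apply]
  linarith

/-- Linearly independent roots whose graph stays connected without the edge `k₀` become
almost balanced after a change of signs of the basis vectors. -/
theorem familyIsometric_almostBalancedRoots {f : Fin n → Space n} (hf : LinearIndependent ℝ f)
    (h : ∀ k, IsRootOn (f k) (p k) (q k)) :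
    FamilyIsometric (simplicesOf f) (simplicesOf (almostBalancedRoots p q k₀)) := by
  rw [familyIsometric_simplicesOf_iff hf (linearIndependent_almostBalancedRoots hc)]
  -- In this dual vector the coordinates have equal absolute value along every edge other than `k₀`.
  -- It is nonzero, hence a positive multiple of a sign vector, and those signs perform the
  -- switching.
  obtain ⟨u, hu⟩ := exists_inner_eq hf (Pi.single k₀ 1)
  choose s t hs ht hf' using fun k => isRootOn_iff.mp (h k)
  simp only [hf', inner_add_smul_stdVec] at hu
  have hconst : ∀ y z, u y * u y = u z * u z := by
    refine hc.eq_of_forall_link (fun y => u y * u y) ?_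
    rintro ⟨k, hk⟩ y z hyz
    have hk' := hu k
    rw [Pi.single_eq_of_ne hk] at hk'
    have : u (p k) * u (p k) = u (q k) * u (q k) := by
      linear_combination (s k * u (p k) - t k * u (q k)) * hk' - u (p k) * u (p k) * hs k +
        u (q k) * u (q k) * ht k
    rcases Sym2.eq_iff.mp hyz with ⟨rfl, rfl⟩ | ⟨rfl, rfl⟩
    · exact this
    · exact this.symm
  have hk₀ := hu k₀
  rw [Pi.single_eq_same] at hk₀
  set m := u (p k₀) * u (p k₀) with hm
  have hm0 : 0 < m := by
    refine lt_of_le_of_ne (mul_self_nonneg _) fun h0 => ?_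
    have h1 : u (p k₀) = 0 := mul_self_eq_zero.mp (hm.symm.trans h0.symm)
    have h2 : u (q k₀) = 0 := mul_self_eq_zero.mp ((hconst (q k₀) (p k₀)).trans h0.symm)
    rw [h1, h2] at hk₀
    simp at hk₀
  obtain ⟨r, hr, hrm⟩ : ∃ r, 0 < r ∧ r * r = m := ⟨√m, Real.sqrt_pos.mpr hm0,
    Real.mul_self_sqrt hm0.le⟩
  have hε : ∀ x, u x / r * (u x / r) = 1 := by
    intro x
    rw [div_mul_div_comm, hconst x (p k₀), ← hm, hrm, div_self hm0.ne']
  obtain ⟨T, hT⟩ := exists_isometry_smul_stdVec hε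
  have hc1 : ∀ k, s k * (u (p k) / r) * (s k * (u (p k) / r)) = 1 := by
    intro k
    linear_combination (u (p k) / r) * (u (p k) / r) * hs k + hε (p k)
  refine ⟨T, Equiv.refl _, fun k => s k * (u (p k) / r), fun k h0 => ?_, fun k => ?_⟩
  · have := hc1 k
    rw [show s k * (u (p k) / r) = 0 from h0] at this
    simp at this
  · rw [hf', map_add, map_smul, map_smul, hT, hT, Equiv.refl_apply, almostBalancedRoots]
    split_ifs with hk
    · subst hk
      have h1 : t k * (u (q k) / r) = s k * (u (p k) / r) := by
        have h2 : t k * (u (q k) / r) * (t k * (u (q k) / r)) = 1 := by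
          linear_combination (u (q k) / r) * (u (q k) / r) * ht k + hε (q k)
        -- Opposite signs would make `f k₀` orthogonal to `u`, while their inner product is 1.
        rcases mul_self_eq_mul_self_iff.mp (h2.trans (hc1 k).symm) with h3 | h3
        · exact h3
        · exfalso
          field_simp at h3
          rw [h3] at hk₀
          simp at hk₀
      rw [smul_smul, smul_smul, h1, smul_add]
    · have h1 : t k * (u (q k) / r) = -(s k * (u (p k) / r)) := by
        have := hu k
        rw [Pi.single_eq_of_ne hk] at this
        field_simp
        linarith
      rw [smul_smul, smul_smul, h1]
      module

end GraphsOfRoots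

/-! ### The graph determines the family -/

section SameGraph

variable {n : ℕ}

theorem exists_ends (a : Fin n → Sym2 (Fin n)) :
    ∃ p q : Fin n → Fin n, a = fun k => s(p k, q k) := by
  have : ∀ k, ∃ p q, a k = s(p, q) := fun k => by
    induction a k using Sym2.ind with
    | h x y => exact ⟨x, y, rfl⟩
  choose p q h using this
  exact ⟨p, q, funext h⟩

/-- Every unicyclic graph with `n` edges is the graph of linearly independent roots, and these
are unique up to isometry. -/
theorem IsUnicyclic.exists_roots {a : Fin n → Sym2 (Fin n)} (h : IsUnicyclic (ofEnds a)) :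
    ∃ g : Fin n → Space n, LinearIndependent ℝ g ∧ (∀ k, g k ∈ rootsD n) ∧
      graphOf g = ofEnds a ∧ ∀ f : Fin n → Space n, LinearIndependent ℝ f →
        graphOf f = ofEnds a → FamilyIsometric (simplicesOf f) (simplicesOf g) := by
  obtain ⟨k₀, hc⟩ := h.exists_isConnected_delete
  have hl := h.2.2.1
  obtain ⟨p, q, rfl⟩ := exists_ends a
  have hpq : ∀ k, p k ≠ q k := fun k hk => ofEnds_loopless.mp hl k hk
  refine ⟨almostBalancedRoots p q k₀, linearIndependent_almostBalancedRoots hc,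
    fun k => ⟨_, _, hpq k, isRootOn_almostBalancedRoots k⟩,
    graphOf_eq_ofEnds_of_isRootOn hpq isRootOn_almostBalancedRoots,
    fun f hf hfa => familyIsometric_almostBalancedRoots hc hf fun k => ?_⟩
  exact ((graphOf_eq_ofEnds.mp hfa k _ _).mp rfl).2

/-- Renaming the basis vectors and the edges takes roots with a given graph to roots with an
isomorphic graph that define an isometric family. -/
theorem exists_roots_of_graphIso {f : Fin n → Space n} (hf : LinearIndependent ℝ f)
    (hroot : ∀ k, f k ∈ rootsD n) {b : Fin n → Sym2 (Fin n)}
    (h : GraphIso (graphOf f) (ofEnds b)) :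
    ∃ g : Fin n → Space n, LinearIndependent ℝ g ∧ graphOf g = ofEnds b ∧
      FamilyIsometric (simplicesOf f) (simplicesOf g) := by
  obtain ⟨a, ha⟩ := exists_graphOf_eq_ofEnds hroot
  rw [ha] at h
  obtain ⟨φ, ψ, h⟩ := graphIso_ofEnds_iff.mp h
  let T : Space n ≃ₗᵢ[ℝ] Space n := LinearIsometryEquiv.piLpCongrLeft 2 ℝ ℝ φ
  have hT : ∀ x, T (stdVec x) = stdVec (φ x) := fun x =>
    EuclideanSpace.piLpCongrLeft_single φ x 1
  have hg : LinearIndependent ℝ fun k => T (f (ψ.symm k)) :=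
    linearIndependent_map_isometry (hf.comp _ ψ.symm.injective) T
  refine ⟨fun k => T (f (ψ.symm k)), hg, ?_, ?_⟩
  · choose p q hpq hk using hroot
    have ha' : ∀ k, a k = s(p k, q k) := fun k =>
      (graphOf_eq_ofEnds.mp ha k _ _).mpr ⟨hpq k, hk k⟩
    rw [graphOf_eq_ofEnds_of_isRootOn (p := fun k => φ (p (ψ.symm k)))
      (q := fun k => φ (q (ψ.symm k)))]
    · congr 1
      ext1 k
      have := h (ψ.symm k)
      rw [ψ.apply_symm_apply, ha', Sym2.map_mk] at this
      exact this.symm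
    · exact fun k h => hpq _ (φ.injective h)
    · intro k
      obtain ⟨s, t, hst⟩ := hk (ψ.symm k)
      exact ⟨s, t, by rw [hst, map_add, map_smul, map_smul, hT, hT]⟩
  · rw [familyIsometric_simplicesOf_iff hf hg]
    exact ⟨T, ψ, fun _ => 1, by simp, by simp⟩

/-- Linearly independent roots with isomorphic unicyclic graphs define isometric families. -/
theorem familyIsometric_of_graphIso {f g : Fin n → Space n} (hf : LinearIndependent ℝ f)
    (hg : LinearIndependent ℝ g) (hfroot : ∀ k, f k ∈ rootsD n) (hgroot : ∀ k, g k ∈ rootsD n)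
    (hu : IsUnicyclic (graphOf g)) (h : GraphIso (graphOf f) (graphOf g)) :
    FamilyIsometric (simplicesOf f) (simplicesOf g) := by
  obtain ⟨b, hb⟩ := exists_graphOf_eq_ofEnds hgroot
  rw [hb] at h hu
  obtain ⟨f', hf', hfb, hff⟩ := exists_roots_of_graphIso hf hfroot h
  obtain ⟨r, -, -, -, hr⟩ := hu.exists_roots
  exact (hff.trans (hr f' hf' hfb)).trans (hr g hg hb).symm

end SameGraph

/-! ### The family determines the graph in dimension at least five -/

section SameFamily

variable {n : ℕ}

/-- Integrality against `h x ± h y` makes the coordinates all integral or all halves of odd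
integers. In the second case the squared norm is at least `n / 4`, which exceeds 1 since `n ≥ 5`; in
dimension four the vectors `(± 1/2, …, ± 1/2)` would survive. -/
theorem eq_smul_stdVec_of_forall_int (hn : 5 ≤ n) {v : Space n} (hv : inner ℝ v v = 1)
    (h : ∀ r ∈ rootsD n, ∃ m : ℤ, inner ℝ r v = m) :
    ∃ (y : Fin n) (e : ℝ), e * e = 1 ∧ v = e • stdVec y := by
  have hadd : ∀ x y, x ≠ y → ∃ m : ℤ, v x + v y = m := by
    intro x y hxy
    obtain ⟨m, hm⟩ := h _ ⟨x, y, hxy, isRootOn_iff.mpr ⟨1, 1, by simp, by simp, rfl⟩⟩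
    exact ⟨m, by rw [← hm, inner_add_smul_stdVec]; ring⟩
  have hsub : ∀ x y, ∃ m : ℤ, v x - v y = m := by
    intro x y
    by_cases hxy : x = y
    · exact ⟨0, by simp [hxy]⟩
    obtain ⟨m, hm⟩ := h _ ⟨x, y, hxy, isRootOn_iff.mpr ⟨1, -1, by simp, by simp, rfl⟩⟩
    exact ⟨m, by rw [← hm, inner_add_smul_stdVec]; ring⟩
  have htwo : ∀ x, ∃ m : ℤ, 2 * v x = m := by
    intro x
    have : Nontrivial (Fin n) := Fin.nontrivial_iff_two_le.mpr (by omega)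
    obtain ⟨y, hy⟩ := exists_ne x
    obtain ⟨m, hm⟩ := hadd x y hy.symm
    obtain ⟨m', hm'⟩ := hsub x y
    exact ⟨m + m', by push_cast; rw [← hm, ← hm']; ring⟩
  choose N hN using htwo
  have hsum : ∑ x, N x * N x = 4 := by
    have h1 : ∑ x, v x * v x = 1 := by
      rw [← hv, PiLp.inner_apply]
      rfl
    have : ((∑ x, N x * N x : ℤ) : ℝ) = ((4 : ℤ) : ℝ) := by
      push_cast
      simp only [← hN]
      calc ∑ x, 2 * v x * (2 * v x) = 4 * ∑ x, v x * v x := by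
            rw [Finset.mul_sum]
            exact Finset.sum_congr rfl fun x _ => by ring
        _ = 4 := by rw [h1, mul_one]
    exact_mod_cast this
  -- All `N x` have the same parity, and `n` odd squares would sum to at least `n`, which exceeds 4.
  have heven : ∀ x, Even (N x) := by
    intro x
    by_contra hx
    have hpos : ∀ y, 1 ≤ N y * N y := by
      intro y
      obtain ⟨m, hm⟩ := hsub x y
      have hxy : N x - N y = 2 * m := by
        have : ((N x - N y : ℤ) : ℝ) = ((2 * m : ℤ) : ℝ) := by
          push_cast
          rw [← hN, ← hN, ← hm]
          ring
        exact_mod_cast this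
      have hy : N y ≠ 0 := by
        intro hy
        exact hx ⟨m, by omega⟩
      have := mul_self_pos.mpr hy
      omega
    have h1 : ∑ _x : Fin n, (1 : ℤ) ≤ ∑ x, N x * N x := Finset.sum_le_sum fun y _ => hpos y
    rw [hsum] at h1
    simp at h1
    omega
  choose M hM using heven
  have hvM : ∀ x, v x = M x := by
    intro x
    have := hN x
    rw [hM] at this
    push_cast at this
    linarith
  have hsumM : ∑ x, M x * M x = 1 := by
    have : ∑ x, N x * N x = 4 * ∑ x, M x * M x := by
      rw [Finset.mul_sum]
      exact Finset.sum_congr rfl fun x _ => by rw [hM]; ring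
    omega
  obtain ⟨y, hy⟩ : ∃ y, M y ≠ 0 := by
    by_contra! h0
    simp [h0] at hsumM
  rw [← Finset.add_sum_erase _ _ (Finset.mem_univ y)] at hsumM
  have hy1 := mul_self_pos.mpr hy
  have h0 : ∑ x ∈ Finset.univ.erase y, M x * M x = 0 := by
    have := Finset.sum_nonneg fun x (_ : x ∈ Finset.univ.erase y) => mul_self_nonneg (M x)
    omega
  refine ⟨y, M y, ?_, ?_⟩
  · have : M y * M y = 1 := by omega
    exact_mod_cast this
  · ext x
    by_cases hx : x = y
    · subst hx
      simp [hvM]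
    · have := (Finset.sum_eq_zero_iff_of_nonneg fun x _ => mul_self_nonneg (M x)).mp h0 x
        (Finset.mem_erase.mpr ⟨hx, Finset.mem_univ x⟩)
      simp [hvM, hx, mul_self_eq_zero.mp this]

/-- A vector with integral inner products with linearly independent roots whose graph is connected
has integral inner products with all roots. -/
theorem inner_int_of_isConnected {f : Fin n → Space n} (hf : LinearIndependent ℝ f)
    (hroot : ∀ k, f k ∈ rootsD n) (hc : IsConnected (graphOf f)) {v : Space n}
    (hv : ∀ k, ∃ m : ℤ, inner ℝ (f k) v = m) {r : Space n} (hr : r ∈ rootsD n) :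
    ∃ m : ℤ, inner ℝ r v = m := by
  -- Integral coordinates are required as well, so that inner products within `R` are integers; this
  -- makes the condition on `v` survive reflections.
  let R : Set (Space n) :=
    {r | (∃ z : Fin n → ℤ, ∀ x, r x = z x) ∧ ∃ m : ℤ, inner ℝ r v = m}
  have hR : ∀ r ∈ R, ∀ r' ∈ R, r' - inner ℝ r r' • r ∈ R := by
    rintro r ⟨⟨z, hz⟩, m, hm⟩ r' ⟨⟨z', hz'⟩, m', hm'⟩
    have hi : inner ℝ r r' = ((∑ x, z' x * z x : ℤ) : ℝ) := by
      push_cast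
      simp only [← hz, ← hz']
      rw [PiLp.inner_apply]
      rfl
    rw [hi]
    refine ⟨⟨fun x => z' x - (∑ x, z' x * z x) * z x, fun x => ?_⟩,
      m' - (∑ x, z' x * z x) * m, ?_⟩
    · rw [PiLp.sub_apply, PiLp.smul_apply, hz, hz', smul_eq_mul]
      norm_cast
    · rw [inner_sub_left, inner_smul_left, hm, hm', conj_trivial]
      norm_cast
  refine (rootsD_subset_of_closed hR hf hroot hc (fun k => ⟨?_, hv k⟩) hr).2
  obtain ⟨x, y, hxy, s, t, h⟩ := hroot k
  rw [h]
  refine ⟨fun w => (Pi.single x (s : ℤ) : Fin n → ℤ) w + (Pi.single y (t : ℤ) : Fin n → ℤ) w,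
    fun w => ?_⟩
  simp only [PiLp.smul_apply, PiLp.add_apply, smul_eq_mul, PiLp.single_apply, Pi.single_apply]
  split_ifs <;> simp

/-- For isometric families of roots, an isometry takes the normals of the first to those of the
second up to signs. -/
theorem exists_isometry_of_familyIsometric {f g : Fin n → Space n} (hf : LinearIndependent ℝ f)
    (hg : LinearIndependent ℝ g) (hfroot : ∀ k, f k ∈ rootsD n) (hgroot : ∀ k, g k ∈ rootsD n)
    (h : FamilyIsometric (simplicesOf f) (simplicesOf g)) :
    ∃ (T : Space n ≃ₗᵢ[ℝ] Space n) (σ : Equiv.Perm (Fin n)) (c : Fin n → ℝ),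
      (∀ k, c k * c k = 1) ∧ ∀ k, T (f k) = c k • g (σ k) := by
  obtain ⟨T, σ, c, -, hT⟩ := (familyIsometric_simplicesOf_iff hf hg).mp h
  refine ⟨T, σ, c, fun k => ?_, hT⟩
  have h1 := T.inner_map_map (f k) (f k)
  rw [hT, inner_smul_left, inner_smul_right, inner_self_of_mem_rootsD (hfroot k),
    inner_self_of_mem_rootsD (hgroot _), conj_trivial] at h1
  linarith

/-- For `n ≥ 5`, the graph of linearly independent roots of `D n` is determined by their
family. -/
theorem graphIso_of_familyIsometric (hn : 5 ≤ n) {f g : Fin n → Space n}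
    (hf : LinearIndependent ℝ f) (hg : LinearIndependent ℝ g) (hfroot : ∀ k, f k ∈ rootsD n)
    (hgroot : ∀ k, g k ∈ rootsD n) (hc : IsConnected (graphOf g))
    (h : FamilyIsometric (simplicesOf f) (simplicesOf g)) :
    GraphIso (graphOf f) (graphOf g) := by
  obtain ⟨T, σ, c, hc1, hT⟩ := exists_isometry_of_familyIsometric hf hg hfroot hgroot h
  have hg' : ∀ k, g (σ k) = c k • T (f k) := fun k => by rw [hT, smul_smul, hc1, one_smul]
  -- The inner products of `h x` with the `f k` are integers, so those of the unit vector `T (h x)`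
  -- with the `g k` are too, and hence with all roots.
  have hbasis : ∀ x, ∃ (y : Fin n) (e : ℝ), e * e = 1 ∧ T (stdVec x) = e • stdVec y := by
    intro x
    refine eq_smul_stdVec_of_forall_int hn ?_ fun r hr =>
      inner_int_of_isConnected hg hgroot hc (fun k => ?_) hr
    · rw [T.inner_map_map, inner_stdVec_left]
      simp
    · obtain ⟨k, rfl⟩ := σ.surjective k
      rw [hg', inner_smul_left, T.inner_map_map, conj_trivial]
      obtain ⟨p, q, hpq, s, t, hk⟩ := hfroot k
      rw [hk, inner_add_smul_stdVec]
      obtain ⟨d, hd⟩ : ∃ d : ℤ, c k = d := by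
        rcases mul_self_eq_one_iff.mp (hc1 k) with h | h
        · exact ⟨1, by simp [h]⟩
        · exact ⟨-1, by simp [h]⟩
      rw [hd]
      simp only [PiLp.single_apply]
      refine ⟨d * (s * (if p = x then 1 else 0) + t * (if q = x then 1 else 0)), ?_⟩
      push_cast
      rfl
  choose π e he hπ using hbasis
  have hinj : Function.Injective π := by
    intro x y hxy
    by_contra hne
    have h1 := T.inner_map_map (stdVec x) (stdVec y)
    rw [hπ, hπ, hxy, inner_smul_left, inner_smul_right, inner_stdVec_left, inner_stdVec_left] at h1
    simp only [PiLp.single_apply, hne, if_false, if_true, mul_one, conj_trivial] at h1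
    have h2 : (e x * e x) * (e y * e y) = 0 := by linear_combination (e x * e y) * h1
    rw [he, he] at h2
    norm_num at h2
  obtain ⟨a, ha⟩ := exists_graphOf_eq_ofEnds hfroot
  obtain ⟨b, hb⟩ := exists_graphOf_eq_ofEnds hgroot
  rw [ha, hb]
  refine graphIso_ofEnds (Equiv.ofBijective π (Finite.injective_iff_bijective.mp hinj)) σ
    fun k => ?_
  obtain ⟨x, y, hxy, hk⟩ := hfroot k
  rw [(graphOf_eq_ofEnds.mp ha k x y).mpr ⟨hxy, hk⟩, Sym2.map_mk]
  refine (graphOf_eq_ofEnds.mp hb _ _ _).mpr ⟨fun h => hxy (hinj h), ?_⟩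
  obtain ⟨s, t, hs, ht, hk⟩ := isRootOn_iff.mp hk
  refine isRootOn_iff.mpr ⟨c k * s * e x, c k * t * e y, ?_, ?_, ?_⟩
  · linear_combination s * s * (e x * e x) * hc1 k + (e x * e x) * hs + he x
  · linear_combination t * t * (e y * e y) * hc1 k + (e y * e y) * ht + he y
  · rw [hg', hk, map_add, map_smul, map_smul, hπ, hπ]
    simp only [Equiv.ofBijective_apply]
    module

end SameFamily

/-! ### Unicyclic graphs with four vertices and a metric invariant -/

section FourVertices

/-- Both functions take each value equally often, so their fibres can be matched one value at a
time. -/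
theorem exists_equiv_of_perm_ofFn {γ : Type*} [DecidableEq γ] {m : ℕ} {f g : Fin m → γ}
    (h : (List.ofFn f).Perm (List.ofFn g)) : ∃ ψ : Equiv.Perm (Fin m), ∀ k, g (ψ k) = f k := by
  have hcard : ∀ y, Nonempty ({k // f k = y} ≃ {k // g k = y}) := by
    intro y
    refine ⟨Fintype.equivOfCardEq ?_⟩
    have key : ∀ f : Fin m → γ, Fintype.card {k // f k = y} = (List.ofFn f).count y := by
      intro f
      rw [← Multiset.coe_count, ← Fin.univ_val_map, Multiset.count_map, Fintype.card_subtype]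
      simp only [eq_comm (a := y)]
      rfl
    rw [key, key, h.count_eq]
  let e := fun y => (hcard y).some
  exact ⟨(Equiv.sigmaFiberEquiv f).symm.trans
    ((Equiv.sigmaCongrRight e).trans (Equiv.sigmaFiberEquiv g)), fun k => (e (f k) ⟨k, rfl⟩).2⟩

/-- The path with three edges, one of whose end edges is doubled. -/
def pathWithDoubleEnd : Graph (Fin 4) (Fin 4) :=
  ofEnds ![s(0, 1), s(0, 1), s(1, 2), s(2, 3)]

/-- The six possible edges on four vertices. -/
def edgeOfFour : Fin 6 → Sym2 (Fin 4) :=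
  ![s(0, 1), s(0, 2), s(0, 3), s(1, 2), s(1, 3), s(2, 3)]

/-- The ends of the edges of the five unicyclic graphs with four vertices. -/
def unicyclicOfFour : List (Fin 4 → Sym2 (Fin 4)) :=
  [![s(0, 1), s(1, 2), s(2, 3), s(3, 0)], ![s(0, 1), s(0, 1), s(0, 2), s(1, 3)],
    ![s(0, 1), s(1, 2), s(2, 0), s(0, 3)], ![s(0, 1), s(0, 1), s(0, 2), s(0, 3)],
    ![s(0, 1), s(0, 1), s(1, 2), s(2, 3)]]

/-- An exhaustive check over multisets of four edges, each listed once by nondecreasing indices. A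
nonconstant labelling that is constant on every edge certifies disconnectedness; products of three
swaps supply the relabellings of vertices. -/
theorem exists_cut_or_perm_unicyclicOfFour : ∀ c₀ c₁ c₂ c₃ : Fin 6, c₀ ≤ c₁ → c₁ ≤ c₂ → c₂ ≤ c₃ →
    (∃ A : Fin 4 → Bool, A 0 = true ∧ (∃ x, A x = false) ∧
      ∀ c ∈ [c₀, c₁, c₂, c₃], ∃ b, ∀ x ∈ edgeOfFour c, A x = b) ∨
    ∃ m ∈ unicyclicOfFour, ∃ i j k : Fin 4, ([c₀, c₁, c₂, c₃].map edgeOfFour).Perm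
      ((List.ofFn m).map (Sym2.map (Equiv.swap 0 i * Equiv.swap 1 j * Equiv.swap 2 k))) := by
  decide +kernel

theorem exists_edgeOfFour_eq : ∀ p q : Fin 4, p ≠ q → ∃ c, edgeOfFour c = s(p, q) := by
  decide

theorem IsUnicyclic.exists_mem_unicyclicOfFour {a : Fin 4 → Sym2 (Fin 4)}
    (h : IsUnicyclic (ofEnds a)) : ∃ m ∈ unicyclicOfFour, GraphIso (ofEnds a) (ofEnds m) := by
  have hc : ∀ k, ∃ c, edgeOfFour c = a k := by
    intro k
    have hk := ofEnds_loopless.mp h.2.2.1 k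
    induction hak : a k using Sym2.ind with
    | h p q =>
      rw [hak, Sym2.mk_isDiag_iff] at hk
      exact exists_edgeOfFour_eq p q hk
  choose c hc using hc
  let τ := Tuple.sort c
  have hmono : Monotone (c ∘ τ) := Tuple.monotone_sort c
  rcases exists_cut_or_perm_unicyclicOfFour (c (τ 0)) (c (τ 1)) (c (τ 2)) (c (τ 3))
    (hmono (by decide)) (hmono (by decide)) (hmono (by decide)) with ⟨A, h0, ⟨x, hx⟩, hA⟩ | h'
  · exfalso
    have hA' : ∀ k, ∃ b, ∀ x ∈ a k, A x = b := by
      intro k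
      rw [← hc]
      apply hA
      obtain ⟨j, rfl⟩ := τ.surjective k
      fin_cases j <;> simp
    have := h.2.1.eq_of_forall_link A (fun k p q hk => by
      obtain ⟨b, hb⟩ := hA' k
      rw [hk] at hb
      rw [hb p (by simp), hb q (by simp)]) 0 x
    rw [h0, hx] at this
    cases this
  · obtain ⟨m, hm, i, j, k, hp⟩ := h'
    refine ⟨m, hm, ?_⟩
    set φ := Equiv.swap 0 i * Equiv.swap 1 j * Equiv.swap 2 k
    have h1 : [c (τ 0), c (τ 1), c (τ 2), c (τ 3)].map edgeOfFour = List.ofFn (a ∘ τ) := by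
      simp [List.ofFn_succ, hc]
    rw [h1, List.map_ofFn] at hp
    obtain ⟨ψ, hψ⟩ := exists_equiv_of_perm_ofFn hp.symm
    refine GraphIso.symm (graphIso_ofEnds φ (ψ.trans τ) fun k => ?_)
    exact hψ k

/-- The number of pairs of edges with exactly one common end. -/
def meetingPairs {n : ℕ} (a : Fin n → Sym2 (Fin n)) : ℕ :=
  (Finset.univ.filter fun kl : Fin n × Fin n =>
    (Finset.univ.filter fun v => v ∈ a kl.1 ∧ v ∈ a kl.2).card = 1).card

/-- The inner product of two roots is `0` or `± 2` if they share both indices, `± 1` if they share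
one, and `0` if they share none. -/
theorem inner_mul_self_eq_one_iff {n : ℕ} {v w : Space n} {p q x y : Fin n} (hpq : p ≠ q)
    (hxy : x ≠ y) (hv : IsRootOn v p q) (hw : IsRootOn w x y) :
    inner ℝ v w * inner ℝ v w = 1 ↔
      (Finset.univ.filter fun z => z ∈ s(p, q) ∧ z ∈ s(x, y)).card = 1 := by
  obtain ⟨s, t, hs, ht, rfl⟩ := isRootOn_iff.mp hv
  obtain ⟨s', t', hs', ht', hw⟩ := isRootOn_iff.mp hw
  have hcard : (Finset.univ.filter fun z => z ∈ s(p, q) ∧ z ∈ s(x, y)) =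
      ({p, q} : Finset (Fin n)).filter fun z => z ∈ s(x, y) := by
    ext z
    simp
  rw [hcard, inner_add_smul_stdVec, Finset.filter_insert, Finset.filter_singleton]
  have hmem : ∀ z, (z ∈ s(x, y) ∧ w z * w z = 1) ∨ (z ∉ s(x, y) ∧ w z = 0) := by
    intro z
    by_cases hzx : z = x
    · subst hzx
      exact Or.inl ⟨by simp, by rw [hw, smul_stdVec_add_apply_left hxy, hs']⟩
    by_cases hzy : z = y
    · subst hzy
      exact Or.inl ⟨by simp, by rw [hw, smul_stdVec_add_apply_right hxy, ht']⟩
    · exact Or.inr ⟨by simp [hzx, hzy], by rw [hw, smul_stdVec_add_apply_of_ne hzx hzy]⟩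
  rcases hmem p with ⟨h1, h2⟩ | ⟨h1, h2⟩ <;> rcases hmem q with ⟨h3, h4⟩ | ⟨h3, h4⟩
  · simp only [h1, h3, if_true, Finset.card_insert_of_notMem (Finset.notMem_singleton.mpr hpq),
      Finset.card_singleton]
    refine iff_of_false (fun h => ?_) (by norm_num)
    have h5 : (s * w p) * (s * w p) = 1 := by linear_combination s * s * h2 + hs
    have h6 : (t * w q) * (t * w q) = 1 := by linear_combination t * t * h4 + ht
    have h7 : 2 * ((s * w p) * (t * w q)) = -1 := by linear_combination h - h5 - h6
    have h8 : ((s * w p) * (t * w q)) * ((s * w p) * (t * w q)) = 1 := by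
      linear_combination (t * w q) * (t * w q) * h5 + h6
    nlinarith
  · simp only [h1, h3, if_true, if_false]
    refine iff_of_true ?_ rfl
    rw [h4]
    linear_combination s * s * h2 + hs
  · simp only [h1, h3, if_true, if_false]
    refine iff_of_true ?_ rfl
    rw [h2]
    linear_combination t * t * h4 + ht
  · simp [h1, h3, h2, h4]

/-- Having exactly one common end is a condition on the square of the inner product, and isometric
families have normals that correspond up to sign. -/
theorem meetingPairs_eq_of_familyIsometric {n : ℕ} {f g : Fin n → Space n}
    (hf : LinearIndependent ℝ f) (hg : LinearIndependent ℝ g) (hfroot : ∀ k, f k ∈ rootsD n)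
    (hgroot : ∀ k, g k ∈ rootsD n) {a b : Fin n → Sym2 (Fin n)} (ha : graphOf f = ofEnds a)
    (hb : graphOf g = ofEnds b) (h : FamilyIsometric (simplicesOf f) (simplicesOf g)) :
    meetingPairs a = meetingPairs b := by
  have key : ∀ (f : Fin n → Space n) (a : Fin n → Sym2 (Fin n)), (∀ k, f k ∈ rootsD n) →
      graphOf f = ofEnds a → ∀ k l, ((Finset.univ.filter fun v => v ∈ a k ∧ v ∈ a l).card = 1 ↔
        inner ℝ (f k) (f l) * inner ℝ (f k) (f l) = 1) := by
    intro f a hfroot ha k l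
    obtain ⟨p, q, hpq, hk⟩ := hfroot k
    obtain ⟨x, y, hxy, hl⟩ := hfroot l
    rw [(graphOf_eq_ofEnds.mp ha k p q).mpr ⟨hpq, hk⟩, (graphOf_eq_ofEnds.mp ha l x y).mpr ⟨hxy, hl⟩]
    exact (inner_mul_self_eq_one_iff hpq hxy hk hl).symm
  obtain ⟨T, σ, c, hc, hT⟩ := exists_isometry_of_familyIsometric hf hg hfroot hgroot h
  refine Finset.card_equiv (σ.prodCongr σ) ?_
  rintro ⟨k, l⟩
  simp only [Finset.mem_filter, Finset.mem_univ, true_and, Equiv.prodCongr_apply, Prod.map]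
  rw [key f a hfroot ha, key g b hgroot hb]
  have h1 := T.inner_map_map (f k) (f l)
  rw [hT, hT, inner_smul_left, inner_smul_right, conj_trivial] at h1
  rw [← h1]
  have h2 : c k * (c l * inner ℝ (g (σ k)) (g (σ l))) * (c k * (c l * inner ℝ (g (σ k)) (g (σ l))))
      = inner ℝ (g (σ k)) (g (σ l)) * inner ℝ (g (σ k)) (g (σ l)) := by
    linear_combination (c l * c l) * (inner ℝ (g (σ k)) (g (σ l)) * inner ℝ (g (σ k)) (g (σ l)))
      * hc k + (inner ℝ (g (σ k)) (g (σ l)) * inner ℝ (g (σ k)) (g (σ l))) * hc l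
  rw [h2]

theorem meetingPairs_eq_of_graphIso {n : ℕ} {a b : Fin n → Sym2 (Fin n)}
    (h : GraphIso (ofEnds a) (ofEnds b)) : meetingPairs a = meetingPairs b := by
  obtain ⟨φ, ψ, h⟩ := graphIso_ofEnds_iff.mp h
  refine Finset.card_equiv (ψ.prodCongr ψ) ?_
  rintro ⟨k, l⟩
  simp only [Finset.mem_filter, Finset.mem_univ, true_and, Equiv.prodCongr_apply, Prod.map]
  have : (Finset.univ.filter fun v => v ∈ a k ∧ v ∈ a l).card =
      (Finset.univ.filter fun v => v ∈ b (ψ k) ∧ v ∈ b (ψ l)).card := by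
    refine Finset.card_equiv φ fun v => ?_
    simp [h, Sym2.mem_map]
  rw [this]

/-- Separates graphs without parallel edges from those with a double edge. -/
theorem injective_of_graphIso {α β γ δ : Type*} {a : β → Sym2 α} {b : δ → Sym2 γ}
    (h : GraphIso (ofEnds a) (ofEnds b)) (hb : Function.Injective b) : Function.Injective a := by
  obtain ⟨φ, ψ, h⟩ := graphIso_ofEnds_iff.mp h
  intro k l hkl
  exact ψ.injective (hb (by rw [h, h, hkl]))

end FourVertices

/-! ### The exceptional identifications in dimension four -/

section ExceptionalIsometries

/-- The roots `h (p k) + t k • h (q k)`. -/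
noncomputable def signedRoots {n : ℕ} (p q : Fin n → Fin n) (t : Fin n → ℝ) (k : Fin n) : Space n :=
  stdVec (p k) + t k • stdVec (q k)

theorem graphOf_signedRoots {n : ℕ} {p q : Fin n → Fin n} {t : Fin n → ℝ} (hpq : ∀ k, p k ≠ q k)
    (ht : ∀ k, t k * t k = 1) : graphOf (signedRoots p q t) = ofEnds fun k => s(p k, q k) :=
  graphOf_eq_ofEnds_of_isRootOn hpq fun k =>
    isRootOn_iff.mpr ⟨1, t k, by simp, ht k, by rw [one_smul]; rfl⟩

theorem signedRoots_mem {n : ℕ} {p q : Fin n → Fin n} {t : Fin n → ℝ} (hpq : ∀ k, p k ≠ q k)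
    (ht : ∀ k, t k * t k = 1) (k : Fin n) : signedRoots p q t k ∈ rootsD n :=
  ⟨_, _, hpq k, isRootOn_iff.mpr ⟨1, t k, by simp, ht k, by rw [one_smul]; rfl⟩⟩

theorem inner_signedRoots {n : ℕ} (p q : Fin n → Fin n) (t : Fin n → ℝ) (k : Fin n) (v : Space n) :
    inner ℝ (signedRoots p q t k) v = v (p k) + t k * v (q k) := by
  have := inner_add_smul_stdVec 1 (t k) (p k) (q k) v
  rwa [one_smul, one_mul] at this

/-- Some family of roots has both graphs, up to isometry. -/
def ShareFamily {n : ℕ} {β : Type*} (X Y : Graph (Fin n) β) : Prop :=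
  ∃ f g : Fin n → Space n, (LinearIndependent ℝ f ∧ (∀ k, f k ∈ rootsD n) ∧ GraphIso (graphOf f) X) ∧
    (LinearIndependent ℝ g ∧ (∀ k, g k ∈ rootsD n) ∧ GraphIso (graphOf g) Y) ∧
    FamilyIsometric (simplicesOf f) (simplicesOf g)

theorem ShareFamily.symm {n : ℕ} {β : Type*} {X Y : Graph (Fin n) β} (h : ShareFamily X Y) :
    ShareFamily Y X := by
  obtain ⟨f, g, hf, hg, h⟩ := h
  exact ⟨g, f, hg, hf, h.symm⟩

/-- The reflection in the hyperplane orthogonal to `(1, 1, 1, 1)`. It preserves the roots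
of `D 4`. -/
noncomputable def sumReflection : Space 4 ≃ₗᵢ[ℝ] Space 4 :=
  (ℝ ∙ (WithLp.toLp 2 (fun _ => 1) : Space 4))ᗮ.reflection

theorem sumReflection_apply (w : Space 4) (x : Fin 4) :
    sumReflection w x = w x - (w 0 + w 1 + w 2 + w 3) / 2 := by
  rw [sumReflection, reflection_orthogonal_singleton_apply, PiLp.inner_apply, PiLp.inner_apply]
  simp only [Fin.sum_univ_four, RCLike.inner_apply, conj_trivial, PiLp.sub_apply, PiLp.smul_apply,
    smul_eq_mul]
  ring

theorem shareFamily_of_sumReflection {p q p' q' : Fin 4 → Fin 4} {t t' c : Fin 4 → ℝ}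
    (hpq : ∀ k, p k ≠ q k) (hpq' : ∀ k, p' k ≠ q' k) (ht : ∀ k, t k * t k = 1)
    (ht' : ∀ k, t' k * t' k = 1) (hc : ∀ k, c k * c k = 1)
    (hf : LinearIndependent ℝ (signedRoots p q t))
    (h : ∀ k, signedRoots p' q' t' k = c k • sumReflection (signedRoots p q t k))
    {X Y : Graph (Fin 4) (Fin 4)} (hX : GraphIso (ofEnds fun k => s(p k, q k)) X)
    (hY : GraphIso (ofEnds fun k => s(p' k, q' k)) Y) : ShareFamily X Y := by
  have hc0 : ∀ k, c k ≠ 0 := by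
    intro k h0
    have := hc k
    rw [h0] at this
    simp at this
  have hg : LinearIndependent ℝ (signedRoots p' q' t') := by
    have := (linearIndependent_map_isometry hf sumReflection).units_smul
      fun k => Units.mk0 (c k) (hc0 k)
    convert this using 1
    ext1 k
    exact h k
  refine ⟨_, _, ⟨hf, signedRoots_mem hpq ht, ?_⟩, ⟨hg, signedRoots_mem hpq' ht', ?_⟩,
    (familyIsometric_simplicesOf_iff hf hg).mpr ⟨sumReflection, Equiv.refl _, c, hc0, fun k => ?_⟩⟩
  · rwa [graphOf_signedRoots hpq ht]
  · rwa [graphOf_signedRoots hpq' ht']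
  · rw [Equiv.refl_apply, h, smul_smul, hc, one_smul]

/-- `sumReflection` fixes `h x - h y` and sends `h x + h y` to minus the sum of the other two basis
vectors. The only plus sign is on the edge from 3 to 0; that edge alone moves, and it becomes
parallel to the edge from 1 to 2. -/
theorem shareFamily_fourCycle : ShareFamily fourCycle doubleEdgeTwoSided := by
  refine shareFamily_of_sumReflection (p := ![0, 1, 2, 3]) (q := ![1, 2, 3, 0])
    (t := ![-1, -1, -1, 1]) (p' := ![0, 1, 2, 1]) (q' := ![1, 2, 3, 2]) (t' := ![-1, -1, -1, 1])
    (c := ![1, 1, 1, -1]) (by decide) (by decide) ?_ ?_ ?_ ?_ ?_ ?_ ?_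
  · intro k; fin_cases k <;> simp
  · intro k; fin_cases k <;> simp
  · intro k; fin_cases k <;> simp
  · refine linearIndependent_of_inner_left_injective fun x hx => ?_
    simp only [inner_signedRoots, Fin.forall_fin_succ] at hx
    simp at hx
    ext y
    fin_cases y <;> simp <;> linarith
  · intro k
    ext y
    rw [PiLp.smul_apply, sumReflection_apply]
    fin_cases k <;> fin_cases y <;> simp [signedRoots]
  · exact graphIso_ofEnds (Equiv.refl _) (Equiv.refl _) (by decide)
  · exact graphIso_ofEnds ⟨![2, 0, 1, 3], ![1, 2, 0, 3], by decide, by decide⟩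
      ⟨![2, 0, 3, 1], ![1, 3, 0, 2], by decide, by decide⟩ (by decide)

/-- Here the plus sign is on the edge from 1 to 2. It moves to the complementary pair 0, 3, opening
the triangle and doubling the pendant edge. -/
theorem shareFamily_triangle : ShareFamily triangleWithPendantEdge doubleEdgeOneSided := by
  refine shareFamily_of_sumReflection (p := ![0, 1, 2, 0]) (q := ![1, 2, 0, 3])
    (t := ![-1, 1, -1, -1]) (p' := ![0, 0, 2, 0]) (q' := ![1, 3, 0, 3]) (t' := ![-1, 1, -1, -1])
    (c := ![1, -1, 1, 1]) (by decide) (by decide) ?_ ?_ ?_ ?_ ?_ ?_ ?_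
  · intro k; fin_cases k <;> simp
  · intro k; fin_cases k <;> simp
  · intro k; fin_cases k <;> simp
  · refine linearIndependent_of_inner_left_injective fun x hx => ?_
    simp only [inner_signedRoots, Fin.forall_fin_succ] at hx
    simp at hx
    ext y
    fin_cases y <;> simp <;> linarith
  · intro k
    ext y
    rw [PiLp.smul_apply, sumReflection_apply]
    fin_cases k <;> fin_cases y <;> simp [signedRoots]
  · exact graphIso_ofEnds (Equiv.refl _) (Equiv.refl _) (by decide)
  · exact graphIso_ofEnds ⟨![0, 2, 3, 1], ![0, 3, 1, 2], by decide, by decide⟩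
      ⟨![2, 0, 3, 1], ![1, 3, 0, 2], by decide, by decide⟩ (by decide)

theorem not_graphIso_of_meetingPairs_ne {n : ℕ} {a b : Fin n → Sym2 (Fin n)}
    (h : meetingPairs a ≠ meetingPairs b) : ¬ GraphIso (ofEnds a) (ofEnds b) :=
  fun h' => h (meetingPairs_eq_of_graphIso h')

/-- The invariant is 8 for the graphs of the first pair and 10 for those of the second. -/
theorem not_graphIso_square {Γ₁ Γ₂ : Graph (Fin 4) (Fin 4)}
    (h₁ : Γ₁ = fourCycle ∨ Γ₁ = doubleEdgeTwoSided)
    (h₂ : Γ₂ = triangleWithPendantEdge ∨ Γ₂ = doubleEdgeOneSided) : ¬ GraphIso Γ₁ Γ₂ := by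
  rcases h₁ with rfl | rfl <;> rcases h₂ with rfl | rfl <;>
    exact not_graphIso_of_meetingPairs_ne (by decide)

theorem not_graphIso_fourCycle : ¬ GraphIso doubleEdgeTwoSided fourCycle := fun h =>
  absurd (injective_of_graphIso h (by decide)) (by decide)

theorem not_graphIso_triangle : ¬ GraphIso doubleEdgeOneSided triangleWithPendantEdge := fun h =>
  absurd (injective_of_graphIso h (by decide)) (by decide)

/-- The shared family is represented by roots with graph `X`, and these are isometric to `f` because
a unicyclic graph determines its family. -/
theorem exists_roots_of_shareFamily {n : ℕ} {β : Type*} {X Y : Graph (Fin n) β}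
    (h : ShareFamily X Y) {f : Fin n → Space n} (hf : LinearIndependent ℝ f)
    (hfroot : ∀ k, f k ∈ rootsD n) (hu : IsUnicyclic (graphOf f)) (hX : GraphIso (graphOf f) X) :
    ∃ g : Fin n → Space n, (LinearIndependent ℝ g ∧ (∀ k, g k ∈ rootsD n)) ∧
      GraphIso (graphOf g) Y ∧ FamilyIsometric (simplicesOf f) (simplicesOf g) := by
  obtain ⟨f', g, ⟨hf', hfroot', hX'⟩, ⟨hg, hgroot, hY⟩, h⟩ := h
  have hff := hX.trans hX'.symm
  exact ⟨g, ⟨hg, hgroot⟩, hY,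
    (familyIsometric_of_graphIso hf hf' hfroot hfroot' (hff.isUnicyclic hu) hff).trans h⟩

/-- Testing the two-colouring by reachability from `x` gives connectedness. The criterion quantifies
over Boolean labellings, so `decide` settles it for explicit graphs. -/
theorem isConnected_of_forall_cut {V β : Type*} [Nonempty V] {a : β → Sym2 V}
    (h : ∀ A : V → Bool, (∀ k, ∃ b, ∀ x ∈ a k, A x = b) → ∀ x y, A x = A y) :
    IsConnected (ofEnds a) := by
  classical
  refine isConnected_ofEnds.mpr ⟨inferInstance, fun x y => ?_⟩
  have := h (fun z => decide (Relation.ReflTransGen (fun x y => ∃ k, a k = s(x, y)) x z))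
    (fun k => ?_) x y
  · exact (decide_eq_decide.mp this).mp Relation.ReflTransGen.refl
  · induction hk : a k using Sym2.ind with
    | h p q =>
      refine ⟨decide (Relation.ReflTransGen (fun x y => ∃ k, a k = s(x, y)) x p),
        fun z hz => decide_eq_decide.mpr ?_⟩
      rcases Sym2.mem_iff.mp hz with rfl | rfl
      · rfl
      · exact ⟨fun h => h.tail ⟨k, hk.trans Sym2.eq_swap⟩, fun h => h.tail ⟨k, hk⟩⟩

theorem isUnicyclic_of_forall_cut {n : ℕ} [NeZero n] {a : Fin n → Sym2 (Fin n)}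
    (hl : ∀ k, ¬ (a k).IsDiag)
    (h : ∀ A : Fin n → Bool, (∀ k, ∃ b, ∀ x ∈ a k, A x = b) → ∀ x y, A x = A y) :
    IsUnicyclic (ofEnds a) :=
  isUnicyclic_ofEnds_iff.mpr ⟨isConnected_of_forall_cut h, ofEnds_loopless.mpr hl, rfl⟩

theorem isUnicyclic_of_eq_square {Γ : Graph (Fin 4) (Fin 4)}
    (h : Γ = fourCycle ∨ Γ = doubleEdgeTwoSided) : IsUnicyclic Γ := by
  rcases h with rfl | rfl
  · exact isUnicyclic_of_forall_cut (by decide) (by decide)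
  · exact isUnicyclic_of_forall_cut (by decide) (by decide)

theorem isUnicyclic_of_eq_triangle {Γ : Graph (Fin 4) (Fin 4)}
    (h : Γ = triangleWithPendantEdge ∨ Γ = doubleEdgeOneSided) : IsUnicyclic Γ := by
  rcases h with rfl | rfl
  · exact isUnicyclic_of_forall_cut (by decide) (by decide)
  · exact isUnicyclic_of_forall_cut (by decide) (by decide)

/-- In dimension four, a family of roots has a graph that is not one of two excluded ones. -/
theorem exists_roots_not_graphIso {Γ₁ Γ₂ : Graph (Fin 4) (Fin 4)}
    (h₁ : Γ₁ = fourCycle ∨ Γ₁ = doubleEdgeTwoSided)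
    (h₂ : Γ₂ = triangleWithPendantEdge ∨ Γ₂ = doubleEdgeOneSided)
    {f : Fin 4 → Space 4} (hf : LinearIndependent ℝ f)
    (hfroot : ∀ k, f k ∈ rootsD 4) (hu : IsUnicyclic (graphOf f)) :
    ∃ g : Fin 4 → Space 4, (LinearIndependent ℝ g ∧ (∀ k, g k ∈ rootsD 4)) ∧
      (¬ GraphIso (graphOf g) Γ₁ ∧ ¬ GraphIso (graphOf g) Γ₂) ∧
      FamilyIsometric (simplicesOf f) (simplicesOf g) ∧ IsUnicyclic (graphOf g) := by
  by_cases hΓ₁ : GraphIso (graphOf f) Γ₁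
  · obtain ⟨Γ', hΓ', hs, hn⟩ : ∃ Γ', (Γ' = fourCycle ∨ Γ' = doubleEdgeTwoSided) ∧
        ShareFamily Γ₁ Γ' ∧ ¬ GraphIso Γ' Γ₁ := by
      rcases h₁ with rfl | rfl
      · exact ⟨_, Or.inr rfl, shareFamily_fourCycle, not_graphIso_fourCycle⟩
      · exact ⟨_, Or.inl rfl, shareFamily_fourCycle.symm, fun h => not_graphIso_fourCycle h.symm⟩
    obtain ⟨g, hg, hY, h⟩ := exists_roots_of_shareFamily hs hf hfroot hu hΓ₁
    exact ⟨g, hg, ⟨fun h => hn (hY.symm.trans h),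
      fun h => not_graphIso_square hΓ' h₂ (hY.symm.trans h)⟩, h,
      hY.symm.isUnicyclic (isUnicyclic_of_eq_square hΓ')⟩
  by_cases hΓ₂ : GraphIso (graphOf f) Γ₂
  · obtain ⟨Γ', hΓ', hs, hn⟩ : ∃ Γ', (Γ' = triangleWithPendantEdge ∨ Γ' = doubleEdgeOneSided) ∧
        ShareFamily Γ₂ Γ' ∧ ¬ GraphIso Γ' Γ₂ := by
      rcases h₂ with rfl | rfl
      · exact ⟨_, Or.inr rfl, shareFamily_triangle, not_graphIso_triangle⟩
      · exact ⟨_, Or.inl rfl, shareFamily_triangle.symm, fun h => not_graphIso_triangle h.symm⟩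
    obtain ⟨g, hg, hY, h⟩ := exists_roots_of_shareFamily hs hf hfroot hu hΓ₂
    exact ⟨g, hg, ⟨fun h => not_graphIso_square h₁ hΓ' (h.symm.trans hY),
      fun h => hn (hY.symm.trans h)⟩, h,
      hY.symm.isUnicyclic (isUnicyclic_of_eq_triangle hΓ')⟩
  · exact ⟨f, ⟨hf, hfroot⟩, ⟨hΓ₁, hΓ₂⟩, FamilyIsometric.refl _, hu⟩

/-- Among the unicyclic graphs with four vertices except the two excluded ones, the number of
pairs of edges with exactly one common end determines the graph. -/
theorem exists_model_of_not_graphIso {Γ₁ Γ₂ : Graph (Fin 4) (Fin 4)}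
    (h₁ : Γ₁ = fourCycle ∨ Γ₁ = doubleEdgeTwoSided)
    (h₂ : Γ₂ = triangleWithPendantEdge ∨ Γ₂ = doubleEdgeOneSided) :
    ∃ M : ℕ → Graph (Fin 4) (Fin 4), ∀ a : Fin 4 → Sym2 (Fin 4), IsUnicyclic (ofEnds a) →
      ¬ GraphIso (ofEnds a) Γ₁ → ¬ GraphIso (ofEnds a) Γ₂ →
        GraphIso (ofEnds a) (M (meetingPairs a)) := by
  -- `Γ₁'` is the other member of the pair of `Γ₁`, the one that is not excluded; likewise `Γ₂'`
  -- below.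
  obtain ⟨Γ₁', hΓ₁'⟩ : ∃ Γ', ∀ X, X = fourCycle ∨ X = doubleEdgeTwoSided → X = Γ₁ ∨ X = Γ' := by
    rcases h₁ with rfl | rfl
    · exact ⟨doubleEdgeTwoSided, fun X h => h⟩
    · exact ⟨fourCycle, fun X h => h.symm⟩
  obtain ⟨Γ₂', hΓ₂'⟩ : ∃ Γ', ∀ X, X = triangleWithPendantEdge ∨ X = doubleEdgeOneSided →
      X = Γ₂ ∨ X = Γ' := by
    rcases h₂ with rfl | rfl
    · exact ⟨doubleEdgeOneSided, fun X h => h⟩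
    · exact ⟨triangleWithPendantEdge, fun X h => h.symm⟩
  -- The values 8 and 10 single out the two pairs, each with one admissible member; the remaining
  -- graph, a path with a doubled end edge, has value 6.
  refine ⟨fun N => if N = 8 then Γ₁' else if N = 10 then Γ₂' else pathWithDoubleEnd,
    fun a hu hn₁ hn₂ => ?_⟩
  have h8 : ∀ X, X = fourCycle ∨ X = doubleEdgeTwoSided → GraphIso (ofEnds a) X →
      GraphIso (ofEnds a) Γ₁' := by
    intro X hX h
    rcases hΓ₁' X hX with rfl | rfl
    · exact absurd h hn₁
    · exact h
  have h10 : ∀ X, X = triangleWithPendantEdge ∨ X = doubleEdgeOneSided → GraphIso (ofEnds a) X →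
      GraphIso (ofEnds a) Γ₂' := by
    intro X hX h
    rcases hΓ₂' X hX with rfl | rfl
    · exact absurd h hn₂
    · exact h
  obtain ⟨m, hm, h⟩ := hu.exists_mem_unicyclicOfFour
  have hN := meetingPairs_eq_of_graphIso h
  simp only [unicyclicOfFour, List.mem_cons, List.not_mem_nil, or_false] at hm
  rcases hm with rfl | rfl | rfl | rfl | rfl
  · rw [hN.trans (show _ = 8 by decide)]
    exact h8 _ (Or.inl rfl) h
  · rw [hN.trans (show _ = 8 by decide)]
    exact h8 _ (Or.inr rfl) h
  · rw [hN.trans (show _ = 10 by decide)]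
    exact h10 _ (Or.inl rfl) h
  · rw [hN.trans (show _ = 10 by decide)]
    exact h10 _ (Or.inr rfl) h
  · rw [hN.trans (show _ = 6 by decide)]
    exact h

end ExceptionalIsometries

/-! ### Assembling the bijection -/

section Correspondence

variable {n : ℕ}

/-- The numbers of vertices differ, so the exclusions are vacuous above dimension four. -/
theorem not_graphIso_of_five_le (hn : 5 ≤ n) {β γ : Type*} {G : Graph (Fin n) β}
    (hV : V(G) = Set.univ) (Γ : Graph (Fin 4) γ) : ¬ GraphIso G Γ := by
  rintro ⟨φ, -, -⟩
  have h : Function.Injective fun x : Fin n => (φ ⟨x, hV ▸ Set.mem_univ x⟩ : Fin 4) := by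
    intro x y hxy
    exact congrArg Subtype.val (φ.injective (Subtype.ext hxy))
  have := Fintype.card_le_of_injective _ h
  simp only [Fintype.card_fin] at this
  omega

theorem HasGraph.of_familyIsometric {β : Type*} {S S' : Set (Set (Space n))}
    {G : Graph (Fin n) β} (h : HasGraph S G) (hS : FamilyIsometric S S') : HasGraph S' G := by
  obtain ⟨f, hf, hroot, hfS, hG⟩ := h
  exact ⟨f, hf, hroot, hfS.trans hS, hG⟩

theorem HasGraph.of_graphIso {β γ : Type*} {S : Set (Set (Space n))} {G : Graph (Fin n) β}
    {H : Graph (Fin n) γ} (h : HasGraph S G) (hGH : GraphIso G H) : HasGraph S H := by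
  obtain ⟨f, hf, hroot, hfS, hG⟩ := h
  exact ⟨f, hf, hroot, hfS, hG.trans hGH⟩

theorem HasGraph.familyIsometric {β : Type*} {S S' : Set (Set (Space n))} {G : Graph (Fin n) β}
    (hu : IsUnicyclic G) (h : HasGraph S G) (h' : HasGraph S' G) : FamilyIsometric S S' := by
  obtain ⟨f, hf, hroot, hfS, hG⟩ := h
  obtain ⟨f', hf', hroot', hfS', hG'⟩ := h'
  exact (hfS.symm.trans (familyIsometric_of_graphIso hf hf' hroot hroot'
    (hG'.symm.isUnicyclic hu) (hG.trans hG'.symm))).trans hfS'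

theorem IsUnicyclic.exists_hasGraph {β : Type*} {G : Graph (Fin n) β} (hV : V(G) = Set.univ)
    (hu : IsUnicyclic G) : ∃ S : FamilyD n, HasGraph S.1 G := by
  obtain ⟨a, ha⟩ := hu.exists_graphIso_ofEnds hV
  have hua := ha.isUnicyclic hu
  obtain ⟨g, hg, hroot, hga, -⟩ := hua.exists_roots
  have hc : IsConnected (graphOf g) := hga ▸ hua.2.1
  refine ⟨⟨simplicesOf g, ⟨g, hg, rfl⟩, g, ⟨hg, rfl⟩, 1, ?_⟩, g, hg, hroot,
    FamilyIsometric.refl _, hga ▸ ha.symm⟩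
  rw [← reflectionGroup_eq_of_isConnected hg hroot hc, map_one]
  exact Subgroup.map_id _

/-- A family that generates `D n` has normals that are roots, up to isometry. -/
theorem GeneratesD.exists_roots [NeZero n] {S : Set (Set (Space n))} (h : GeneratesD S) :
    ∃ r : Fin n → Space n, LinearIndependent ℝ r ∧ (∀ k, r k ∈ rootsD n) ∧
      IsConnected (graphOf r) ∧ FamilyIsometric (simplicesOf r) S := by
  obtain ⟨f, ⟨hf, rfl⟩, T, hT⟩ := h
  rw [map_conj_reflectionGroup] at hT
  have hTf := linearIndependent_map_isometry hf T
  have hex := fun k => exists_smul_root_of_reflection_mem (hTf.ne_zero k)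
    (hT ▸ reflection_mem_reflectionGroup ⟨k, rfl⟩)
  choose c r hc hroot hr using hex
  have hr' : ∀ k, r k = (c k)⁻¹ • T (f k) := fun k => by
    rw [hr, smul_smul, inv_mul_cancel₀ (hc k), one_smul]
  have hrli : LinearIndependent ℝ r := by
    have := hTf.units_smul fun k => Units.mk0 (c k)⁻¹ (inv_ne_zero (hc k))
    convert this using 1
    ext1 k
    exact hr' k
  refine ⟨r, hrli, hroot, isConnected_of_reflectionGroup_eq hroot ?_,
    ((familyIsometric_simplicesOf_iff hf hrli).mpr ⟨T, Equiv.refl _, c, hc, hr⟩).symm⟩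
  rw [← hT, ← reflectionGroup_smul hc]
  congr 2
  ext1 k
  exact (hr k).symm

variable {Γ₁ Γ₂ : Graph (Fin 4) (Fin 4)}
  (h₁ : Γ₁ = fourCycle ∨ Γ₁ = doubleEdgeTwoSided)
  (h₂ : Γ₂ = triangleWithPendantEdge ∨ Γ₂ = doubleEdgeOneSided)
include h₁ h₂

/-- Surjectivity of the correspondence: the roots of a generating family have a unicyclic graph, and
in dimension four an excluded graph is exchanged for its partner, which belongs to an isometric
family. -/
theorem exists_admissibleGraph (hn : 4 ≤ n) (S : FamilyD n) :
    ∃ G : AdmissibleGraph n Γ₁ Γ₂, HasGraph S.1 G.1 := by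
  have : NeZero n := ⟨by omega⟩
  obtain ⟨f, hf, hfroot, hc, hfS⟩ := S.2.2.exists_roots
  have hu := isUnicyclic_graphOf hfroot hc
  obtain ⟨g, ⟨hg, hgroot⟩, ⟨hn₁, hn₂⟩, hgS, hgu⟩ : ∃ g : Fin n → Space n,
      (LinearIndependent ℝ g ∧ (∀ k, g k ∈ rootsD n)) ∧
      (¬ GraphIso (graphOf g) Γ₁ ∧ ¬ GraphIso (graphOf g) Γ₂) ∧
      FamilyIsometric (simplicesOf g) S.1 ∧ IsUnicyclic (graphOf g) := by
    rcases hn.lt_or_eq with hn | rfl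
    · exact ⟨f, ⟨hf, hfroot⟩, ⟨not_graphIso_of_five_le hn rfl _, not_graphIso_of_five_le hn rfl _⟩,
        hfS, hu⟩
    · obtain ⟨g, ⟨hg, hgroot⟩, hgn, hfg, hgu⟩ := exists_roots_not_graphIso h₁ h₂ hf hfroot hu
      exact ⟨g, ⟨hg, hgroot⟩, hgn, hfg.symm.trans hfS, hgu⟩
  obtain ⟨a, ha⟩ := exists_graphOf_eq_ofEnds hgroot
  -- Admissible graphs have edge names in `ℕ`, so the edges are renamed along the inclusion of `Fin
  -- n`.
  obtain ⟨G, hV, hG⟩ := exists_graphIso_edge_embedding a Fin.valEmbedding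
  rw [← ha] at hG
  exact ⟨⟨G, hV, hG.symm.isUnicyclic hgu, fun h => hn₁ (hG.symm.trans h),
    fun h => hn₂ (hG.symm.trans h)⟩, g, hg, hgroot, hgS, hG.symm⟩

/-- Injectivity of the correspondence. Above dimension four the isometry itself yields the
isomorphism; in dimension four both graphs are isomorphic to the model attached to their common
invariant. -/
theorem graphIso_of_hasGraph (hn : 4 ≤ n) {S : Set (Set (Space n))}
    (G G' : AdmissibleGraph n Γ₁ Γ₂) (h : HasGraph S G.1) (h' : HasGraph S G'.1) :
    GraphIso G.1 G'.1 := by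
  obtain ⟨G, hV, hu, hG₁, hG₂⟩ := G
  obtain ⟨G', hV', hu', hG₁', hG₂'⟩ := G'
  obtain ⟨f, hf, hroot, hfS, hG⟩ := h
  obtain ⟨f', hf', hroot', hfS', hG'⟩ := h'
  have hff := hfS.trans hfS'.symm
  have hfu := hG.symm.isUnicyclic hu
  have hfu' := hG'.symm.isUnicyclic hu'
  refine hG.symm.trans (GraphIso.trans ?_ hG')
  rcases hn.lt_or_eq with hn | rfl
  · exact graphIso_of_familyIsometric hn hf hf' hroot hroot' hfu'.2.1 hff
  · obtain ⟨a, ha⟩ := exists_graphOf_eq_ofEnds hroot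
    obtain ⟨b, hb⟩ := exists_graphOf_eq_ofEnds hroot'
    have hab := meetingPairs_eq_of_familyIsometric hf hf' hroot hroot' ha hb hff
    rw [ha] at hfu hG ⊢
    rw [hb] at hfu' hG' ⊢
    obtain ⟨M, hM⟩ := exists_model_of_not_graphIso h₁ h₂
    have ha' := hM a hfu (fun h => hG₁ (hG.symm.trans h)) fun h => hG₂ (hG.symm.trans h)
    have hb' := hM b hfu' (fun h => hG₁' (hG'.symm.trans h)) fun h => hG₂' (hG'.symm.trans h)
    rw [hab] at ha'
    exact ha'.trans hb'.symm

end Correspondence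

end DnFamilies

theorem theorem3 (n : ℕ) (hn : 4 ≤ n) (Γ₁ Γ₂ : Graph (Fin 4) (Fin 4))
    (h₁ : Γ₁ = DnFamilies.fourCycle ∨ Γ₁ = DnFamilies.doubleEdgeTwoSided)
    (h₂ : Γ₂ = DnFamilies.triangleWithPendantEdge ∨ Γ₂ = DnFamilies.doubleEdgeOneSided) :
    ∃ b : DnFamilies.GraphClass n Γ₁ Γ₂ ≃ DnFamilies.FamilyClass n,
      ∀ (G : DnFamilies.AdmissibleGraph n Γ₁ Γ₂) (S : DnFamilies.FamilyD n),
        b (Quotient.mk _ G) = Quotient.mk _ S ↔ DnFamilies.HasGraph S.1 G.1 := by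
  open DnFamilies in
  choose F hF using fun G : AdmissibleGraph n Γ₁ Γ₂ => G.2.2.1.exists_hasGraph G.2.1
  -- Well defined, whatever families `F` selects, because a unicyclic graph determines its family up
  -- to isometry.
  let b : GraphClass n Γ₁ Γ₂ → FamilyClass n := Quotient.map F fun G G' hGG' =>
    HasGraph.familyIsometric G'.2.2.1 ((hF G).of_graphIso hGG') (hF G')
  have hb : ∀ (G : AdmissibleGraph n Γ₁ Γ₂) (S : FamilyD n),
      b (Quotient.mk _ G) = Quotient.mk _ S ↔ HasGraph S.1 G.1 := by
    intro G S
    rw [show b (Quotient.mk _ G) = Quotient.mk _ (F G) from rfl, Quotient.eq]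
    exact ⟨fun h => (hF G).of_familyIsometric h, fun h => (hF G).familyIsometric G.2.2.1 h⟩
  have hbij : Function.Bijective b := by
    constructor
    · intro x y
      induction x, y using Quotient.inductionOn₂ with
      | h G G' =>
        intro h
        exact Quotient.sound (graphIso_of_hasGraph h₁ h₂ hn G G' ((hb G (F G')).mp h) (hF G'))
    · intro y
      induction y using Quotient.inductionOn with
      | h S =>
        obtain ⟨G, hG⟩ := exists_admissibleGraph h₁ h₂ hn S
        exact ⟨Quotient.mk _ G, (hb G S).mpr hG⟩
  exact ⟨Equiv.ofBijective b hbij, hb⟩
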